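/- Let $H=(H_t)_{t\ge 0}$ be a (possibly killed) subordinator, with values in $[0,\infty]$ and $\infty$ as cemetery state. Suppose that its Lévy measure has a density $\Upsilon:(0,\infty)\to(0,\infty)$, i.e. that for some killing rate $\kappa\ge 0$ and drift ${\rm d}\ge 0$ $$\mathbb{E}\big(e^{-\theta H_t};\,H_t<\infty\big)=e^{-t\phi(\theta)},\qquad \phi(\theta)=\kappa+{\rm d}\,\theta+\int_0^\infty(1-e^{-\theta x})\Upsilon(x)\,dx,\qquad t,\theta\ge 0,$$ where $\int_0^\infty(1\wedge x)\Upsilon(x)\,dx<\infty$. Suppose that $\Upsilon$ is log convex, i.e. $\log\Upsilon$ is convex on $(0,\infty)$. Then $\Upsilon$ is non-increasing, and the restriction to $(0,\infty)$ of the potential measure $U(A)=\int_0^\infty\mathbb{P}(H_t<\infty,\ H_t\in A)\,dt$ has a density $u:(0,\infty)\to[0,\infty)$ with respect to Lebesgue measure which is non-increasing and convex. If furthermore ${\rm d}>0$, then this density $u$ is in $C^1(0,\infty)$. -/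

import Mathlib

open MeasureTheory Set
open scoped NNReal ENNReal

/-- A (possibly killed) subordinator: a process `H` with values in `[0, ∞]`, where `∞` is the
cemetery, started at `0`, with almost surely non-decreasing right-continuous paths (so that `∞`
is absorbing), such that for all `s, t ≥ 0`, conditionally on `H t < ∞`, the increment
`H (t + s) - H t` is independent of `(H u)_{u ≤ t}` and has the law of `H s`.
The lifetime is `inf {t | H t = ∞}`; it may be infinite almost surely. -/
structure IsSubordinator {Ω : Type*} [MeasurableSpace Ω]
    (H : ℝ≥0 → Ω → ℝ≥0∞) (P : Measure Ω) : Prop where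
  measurable : ∀ t, Measurable (H t)
  paths : ∀ᵐ ω ∂P, H 0 ω = 0 ∧ Monotone (fun t => H t ω) ∧
    ∀ t, ContinuousWithinAt (fun s => H s ω) (Ici t) t
  increments : ∀ (s t : ℝ≥0) (A : Set Ω) (B : Set ℝ≥0∞),
    MeasurableSet[⨆ u : Iic t, MeasurableSpace.comap (H u) inferInstance] A →
    MeasurableSet B →
    P (A ∩ {ω | H t ω < ∞} ∩ {ω | H (t + s) ω - H t ω ∈ B})
      = P (A ∩ {ω | H t ω < ∞}) * P {ω | H s ω ∈ B}

/-- `φ` is the Laplace exponent of `H`: `E[exp (-θ H_t)] = exp (-t φ(θ))` for all `t, θ ≥ 0`,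
with the convention `exp (-θ ∞) = 0`, also for `θ = 0`. -/
def HasLaplaceExponent {Ω : Type*} [MeasurableSpace Ω]
    (H : ℝ≥0 → Ω → ℝ≥0∞) (P : Measure Ω) (φ : ℝ → ℝ) : Prop :=
  ∀ (t : ℝ≥0) (θ : ℝ), 0 ≤ θ →
    ∫ ω in {ω | H t ω < ∞}, Real.exp (-θ * (H t ω).toReal) ∂P = Real.exp (-(t : ℝ) * φ θ)

/-- `H` has killing rate `κ`, drift `d` and a Lévy measure with density `Υ` on `(0, ∞)`:
its Laplace exponent is `φ(θ) = κ + d θ + ∫_0^∞ (1 - exp (-θ x)) Υ(x) dx`. -/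
structure HasLevyDensity {Ω : Type*} [MeasurableSpace Ω]
    (H : ℝ≥0 → Ω → ℝ≥0∞) (P : Measure Ω) (κ d : ℝ) (Υ : ℝ → ℝ) : Prop where
  killing_nonneg : 0 ≤ κ
  drift_nonneg : 0 ≤ d
  density_nonneg : ∀ x ∈ Ioi (0 : ℝ), 0 ≤ Υ x
  integrable : IntegrableOn (fun x => min 1 x * Υ x) (Ioi 0)
  laplace : HasLaplaceExponent H P
    (fun θ => κ + d * θ + ∫ x in Ioi (0 : ℝ), (1 - Real.exp (-θ * x)) * Υ x)

/-- `f` is (strictly positive and) log convex on `s`. -/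
def LogConvexOn (s : Set ℝ) (f : ℝ → ℝ) : Prop :=
  (∀ x ∈ s, 0 < f x) ∧ ConvexOn ℝ s (fun x => Real.log (f x))

/-- The potential measure `U(A) = ∫_0^∞ P(H_t < ∞, H_t ∈ A) dt` of `H`, as a measure on `ℝ`
(see `potentialMeasure_apply`). -/
noncomputable def potentialMeasure {Ω : Type*} [MeasurableSpace Ω]
    (H : ℝ≥0 → Ω → ℝ≥0∞) (P : Measure Ω) : Measure ℝ :=
  (volume.restrict (Ici (0 : ℝ))).bind fun t =>
    (P.restrict {ω | H t.toNNReal ω < ∞}).map fun ω => (H t.toNNReal ω).toReal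

theorem potentialMeasure_apply {Ω : Type*} [MeasurableSpace Ω] {H : ℝ≥0 → Ω → ℝ≥0∞}
    {P : Measure Ω} [IsProbabilityMeasure P] (hH : IsSubordinator H P)
    {A : Set ℝ} (hA : MeasurableSet A) :
    potentialMeasure H P A = ∫⁻ t in Ici (0 : ℝ),
      P {ω | H t.toNNReal ω < ∞ ∧ (H t.toNNReal ω).toReal ∈ A} := by
  have happ : ∀ (t : ℝ) {B : Set ℝ}, MeasurableSet B →
      (P.restrict {ω | H t.toNNReal ω < ∞}).map (fun ω => (H t.toNNReal ω).toReal) B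
        = P {ω | H t.toNNReal ω < ∞ ∧ (H t.toNNReal ω).toReal ∈ B} := by
    intro t B hB
    have hm := hH.measurable t.toNNReal
    rw [Measure.map_apply hm.ennreal_toReal hB,
      Measure.restrict_apply (hm.ennreal_toReal hB)]
    congr 1
    ext ω
    simp [and_comm]
  have hanti : ∀ c : ℝ, Antitone fun t : ℝ =>
      P {ω | H t.toNNReal ω < ∞ ∧ (H t.toNNReal ω).toReal ≤ c} := by
    intro c r t hrt
    refine measure_mono_ae ?_
    filter_upwards [hH.paths] with ω hω h
    have hle := hω.2.1 (Real.toNNReal_le_toNNReal hrt)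
    exact ⟨hle.trans_lt h.1, (ENNReal.toReal_mono h.1.ne hle).trans h.2⟩
  have hanti' : Antitone fun t : ℝ => P {ω | H t.toNNReal ω < ∞} := by
    intro r t hrt
    refine measure_mono_ae ?_
    filter_upwards [hH.paths] with ω hω h
    exact (hω.2.1 (Real.toNNReal_le_toNNReal hrt)).trans_lt h
  have hmeas : Measurable fun t : ℝ =>
      (P.restrict {ω | H t.toNNReal ω < ∞}).map fun ω => (H t.toNNReal ω).toReal := by
    have hfin : ∀ t : ℝ, IsFiniteMeasure
        ((P.restrict {ω | H t.toNNReal ω < ∞}).map fun ω => (H t.toNNReal ω).toReal) :=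
      fun t => inferInstance
    refine Measurable.measure_of_isPiSystem (borel_eq_generateFrom_Iic ℝ ▸
      BorelSpace.measurable_eq) isPiSystem_Iic ?_ ?_
    · rintro _ ⟨c, rfl⟩
      simp_rw [happ _ measurableSet_Iic]
      exact (hanti c).measurable
    · simp_rw [happ _ MeasurableSet.univ]
      simpa using hanti'.measurable
  rw [potentialMeasure, Measure.bind_apply hA hmeas.aemeasurable]
  exact lintegral_congr fun t => happ t hA

/-!
Write `φ` for the Laplace exponent. The potential measure `U` has Laplace transform `1 / φ`, and it
is a limit of renewal measures for which convexity is a statement about sequences.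

*Discrete case.* Let `b` be positive and log convex, with positive log convex decrements
`b k - b (k + 1)`, and let `∑ k ≤ n, b k * u (n - k) = 1` for all `n`. Then `u` is nonnegative,
non-increasing (`renewal_antitone`, Kaluza's lemma) and convex (`renewal_convex`).

*Approximation.* Move the Lévy measure to the grid `h ℕ` and replace the drift `d` by jumps of size
`h` at rate `d / h`. The tail sequence `discreteTail` of this compound Poisson process has the
properties above, because integrals of a log convex function over translates of a set are log
convex. Its Laplace exponents converge to `φ` as `h → 0` (`LogConvexOn.tendsto_discreteExponent`),
so its renewal measures converge vaguely to `U` (`tendsto_integral_of_tendsto_laplaceTransform`). With `h` a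
divisor of `s`, the inequalities between masses become inequalities between the measures of
intervals and of their translates by `s` and `2 s`, which hold for `U` in the limit. Hence the
distribution function of `U` is concave and its increments are convex, and its right derivative is
a non-increasing convex density (`exists_convex_density_of_translates`).

*Differentiability.* Let `d > 0`, and let `w` be minus the right derivative of the density `u`. Like
every non-increasing convex function, `u` is up to a constant the tail `∫_x^∞ w`, and this
determines the Laplace transform of `w` as `1 / d - θ / φ(θ)`
(`LogConvexOn.lintegral_exp_mul_deriv_density`). With `Π̄` the tail of the Lévy measure, whose
Laplace transform is `φ(θ) / θ - d`, it follows that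
`d w + w * Π̄ = Π̄ / d` almost everywhere (`LogConvexOn.deriv_density_add_conv`). Both `Π̄` and the
convolution `w * Π̄` are continuous on `(0, ∞)` (`continuousAt_lintegral_conv`), so the monotone
function `w` is continuous.
-/

open Filter Topology

/-! ### Renewal sequences of log convex tail sequences -/

/-- The ratios of successive terms of a positive log convex sequence are non-decreasing. -/
theorem succ_mul_le_mul_succ_of_logConvex {g : ℕ → ℝ} (hpos : ∀ n, 0 < g n)
    (hlc : ∀ n, g (n + 1) ^ 2 ≤ g n * g (n + 2)) {k n : ℕ} (hkn : k ≤ n) :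
    g (k + 1) * g n ≤ g k * g (n + 1) := by
  have hmono : Monotone fun n => g (n + 1) / g n := by
    refine monotone_nat_of_le_succ fun m => ?_
    rw [div_le_div_iff₀ (hpos _) (hpos _)]
    nlinarith [hlc m]
  have h := hmono hkn
  simp only at h
  rw [div_le_div_iff₀ (hpos _) (hpos _)] at h
  linarith

section Renewal

variable {b u : ℕ → ℝ}

theorem renewal_zero (hu : ∀ n, ∑ k ∈ Finset.range (n + 1), b k * u (n - k) = 1) :
    b 0 * u 0 = 1 := by
  simpa using hu 0

theorem renewal_nonneg (hb : ∀ n, 0 < b n) (hanti : ∀ n, b (n + 1) ≤ b n)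
    (hu : ∀ n, ∑ k ∈ Finset.range (n + 1), b k * u (n - k) = 1) (n : ℕ) : 0 ≤ u n := by
  induction n using Nat.strong_induction_on with
  | _ n ih =>
  rcases n with _ | n
  · have := renewal_zero hu
    nlinarith [hb 0]
  · have h1 := hu (n + 1)
    have h0 := hu n
    rw [Finset.sum_range_succ'] at h1
    simp only [Nat.add_sub_add_right, Nat.sub_zero] at h1
    have h2 : b 0 * u (n + 1) = ∑ k ∈ Finset.range (n + 1), (b k - b (k + 1)) * u (n - k) := by
      simp only [sub_mul, Finset.sum_sub_distrib]
      linarith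
    have h3 : 0 ≤ b 0 * u (n + 1) := by
      rw [h2]
      exact Finset.sum_nonneg fun k _ =>
        mul_nonneg (sub_nonneg.2 (hanti k)) (ih _ (by omega))
    exact nonneg_of_mul_nonneg_right h3 (hb 0)

/-- The decrements of `u` solve the renewal equation with right-hand side
`b (n + 1) / b 0`. -/
theorem renewal_diff (hb : ∀ n, 0 < b n)
    (hu : ∀ n, ∑ k ∈ Finset.range (n + 1), b k * u (n - k) = 1) (n : ℕ) :
    ∑ k ∈ Finset.range (n + 1), b k * (u (n - k) - u (n - k + 1)) = b (n + 1) / b 0 := by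
  have h1 := hu (n + 1)
  have h0 := hu n
  have hz := renewal_zero hu
  rw [Finset.sum_range_succ] at h1
  have h2 : ∑ k ∈ Finset.range (n + 1), b k * u (n + 1 - k)
      = ∑ k ∈ Finset.range (n + 1), b k * u (n - k + 1) := by
    refine Finset.sum_congr rfl fun k hk => ?_
    rw [Nat.sub_add_comm (Finset.mem_range_succ_iff.1 hk)]
  simp only [mul_sub, Finset.sum_sub_distrib]
  rw [h2] at h1
  rw [Nat.sub_self] at h1
  have : b (n + 1) / b 0 = b (n + 1) * u 0 := by
    rw [div_eq_iff (hb 0).ne']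
    linear_combination (-b (n + 1)) * hz
  linarith

/-- **Kaluza's lemma.** If `b` is log convex, the solution of the renewal equation `b * u = 1`
is non-increasing. -/
theorem renewal_antitone (hb : ∀ n, 0 < b n)
    (hlc : ∀ n, b (n + 1) ^ 2 ≤ b n * b (n + 2))
    (hu : ∀ n, ∑ k ∈ Finset.range (n + 1), b k * u (n - k) = 1) (n : ℕ) : u (n + 1) ≤ u n := by
  suffices h : ∀ n, 0 ≤ u n - u (n + 1) from sub_nonneg.1 (h n)
  clear n
  intro n
  have hd := renewal_diff hb hu
  set w : ℕ → ℝ := fun n => u n - u (n + 1) with hw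
  have hd' : ∀ n, ∑ k ∈ Finset.range (n + 1), b k * w (n - k) = b (n + 1) / b 0 := hd
  change 0 ≤ w n
  induction n using Nat.strong_induction_on with
  | _ n ih =>
  rcases n with _ | n
  · have := hd' 0
    simp only [Finset.range_one, Finset.sum_singleton, zero_add, Nat.sub_zero] at this
    have h2 : 0 ≤ b 0 * w 0 := by rw [this]; exact (div_pos (hb _) (hb _)).le
    exact nonneg_of_mul_nonneg_right h2 (hb 0)
  · have h1 := hd' (n + 1)
    have h0 := hd' n
    rw [Finset.sum_range_succ'] at h1
    simp only [Nat.add_sub_add_right, Nat.sub_zero] at h1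
    have hle : b (n + 1) * ∑ k ∈ Finset.range (n + 1), b (k + 1) * w (n - k)
        ≤ b (n + 2) * ∑ k ∈ Finset.range (n + 1), b k * w (n - k) := by
      rw [Finset.mul_sum, Finset.mul_sum]
      refine Finset.sum_le_sum fun k hk => ?_
      have hk' : k ≤ n + 1 := (Finset.mem_range.1 hk).le
      have := mul_le_mul_of_nonneg_right
        (succ_mul_le_mul_succ_of_logConvex hb hlc hk') (ih (n - k) (by omega))
      linarith
    rw [h0] at hle
    have h3 : 0 ≤ b (n + 1) * (b 0 * w (n + 1)) := by
      have : b (n + 1) * (b 0 * w (n + 1)) = b (n + 1) * (b (n + 2) / b 0)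
          - b (n + 1) * ∑ k ∈ Finset.range (n + 1), b (k + 1) * w (n - k) := by
        rw [← h1]; ring
      rw [this]
      have : b (n + 2) * (b (n + 1) / b 0) = b (n + 1) * (b (n + 2) / b 0) := by ring
      linarith
    exact nonneg_of_mul_nonneg_right (nonneg_of_mul_nonneg_right h3 (hb _)) (hb 0)

/-- If `b` and its decrements are log convex, the solution of the renewal equation `b * u = 1` is
convex. Kaluza's argument for the decrements `w` of `u` uses that the decrements `g` of `b`
have increasing ratios. It applies to the differences `w k - w n`, which are nonnegative by induction; the terms
left over are `w n ≥ 0` times a quantity that log convexity of `b` controls. -/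
theorem renewal_convex (hb : ∀ n, 0 < b n) (hstrict : ∀ n, b (n + 1) < b n)
    (hlc : ∀ n, b (n + 1) ^ 2 ≤ b n * b (n + 2))
    (hlc' : ∀ n, (b (n + 1) - b (n + 2)) ^ 2 ≤ (b n - b (n + 1)) * (b (n + 2) - b (n + 3)))
    (hu : ∀ n, ∑ k ∈ Finset.range (n + 1), b k * u (n - k) = 1) (n : ℕ) :
    2 * u (n + 1) ≤ u n + u (n + 2) := by
  have hd := renewal_diff hb hu
  have hw0 : ∀ n, 0 ≤ u n - u (n + 1) := fun n =>
    sub_nonneg.2 (renewal_antitone hb hlc hu n)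
  suffices h : ∀ n, u (n + 1) - u (n + 1 + 1) ≤ u n - u (n + 1) by
    have := h n
    rw [show n + 1 + 1 = n + 2 from rfl] at this
    linarith
  clear n
  set w : ℕ → ℝ := fun n => u n - u (n + 1) with hw
  have hd' : ∀ n, ∑ k ∈ Finset.range (n + 1), b k * w (n - k) = b (n + 1) / b 0 := hd
  have hw0' : ∀ n, 0 ≤ w n := hw0
  set g : ℕ → ℝ := fun n => b n - b (n + 1) with hg
  have hg0 : ∀ n, 0 < g n := fun n => sub_pos.2 (hstrict n)
  have hglc : ∀ n, g (n + 1) ^ 2 ≤ g n * g (n + 2) := hlc'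
  -- The renewal equation for `w`, in terms of the increments of `b`
  have hren : ∀ n, b 0 * w (n + 1)
      = ∑ k ∈ Finset.range (n + 1), g k * w (n - k) - g (n + 1) / b 0 := by
    intro n
    have h1 := hd' (n + 1)
    have h0 := hd' n
    rw [Finset.sum_range_succ'] at h1
    simp only [Nat.add_sub_add_right, Nat.sub_zero] at h1
    simp only [hg, sub_mul, Finset.sum_sub_distrib, sub_div]
    linarith
  have hren0 : b 0 * w 0 = 1 - g 0 / b 0 := by
    have h0 := hd' 0
    simp only [Finset.range_one, Finset.sum_singleton, zero_add, Nat.sub_zero] at h0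
    rw [h0, hg]
    have := (hb 0).ne'
    field_simp
    ring
  have hsum : ∀ n, ∑ k ∈ Finset.range n, g k = b 0 - b n := fun n => by
    simpa [hg] using Finset.sum_range_sub' b n
  intro n
  change w (n + 1) ≤ w n
  induction n using Nat.strong_induction_on with
  | _ n ih =>
  have hle : ∀ k ≤ n, w n ≤ w k := by
    intro k hk
    obtain ⟨j, rfl⟩ := Nat.exists_eq_add_of_le hk
    clear hk
    induction j with
    | zero => exact le_rfl
    | succ j ihj =>
      exact (ih (k + j) (by omega)).trans (ihj fun m hm => ih m (by omega))
  -- the equation one step earlier, as an inequality valid also for `n = 0`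
  have hprev : ∑ k ∈ Finset.range n, g k * w (n - 1 - k) - g n / b 0 ≤ b 0 * w n := by
    rcases n with _ | n
    · rw [hren0]; simp
    · rw [hren n]; simp
  have hstep : b 0 * w (n + 1) = g 0 * w n
      + ∑ k ∈ Finset.range n, g (k + 1) * w (n - 1 - k) - g (n + 1) / b 0 := by
    rw [hren n, Finset.sum_range_succ']
    simp only [Nat.sub_zero]
    have : ∑ k ∈ Finset.range n, g (k + 1) * w (n - (k + 1))
        = ∑ k ∈ Finset.range n, g (k + 1) * w (n - 1 - k) :=
      Finset.sum_congr rfl fun k _ => by rw [show n - (k + 1) = n - 1 - k by omega]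
    rw [this]
    ring
  have hmain : g n * ∑ k ∈ Finset.range n, g (k + 1) * (w (n - 1 - k) - w n)
      ≤ g (n + 1) * ∑ k ∈ Finset.range n, g k * (w (n - 1 - k) - w n) := by
    rw [Finset.mul_sum, Finset.mul_sum]
    refine Finset.sum_le_sum fun k hk => ?_
    have hk' : k ≤ n := (Finset.mem_range.1 hk).le
    have := mul_le_mul_of_nonneg_right
      (succ_mul_le_mul_succ_of_logConvex hg0 hglc hk')
      (sub_nonneg.2 (hle (n - 1 - k) (by omega)))
    linarith
  have hs1 : ∑ k ∈ Finset.range n, g (k + 1) = b 0 - b (n + 1) - g 0 := by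
    have := hsum (n + 1)
    rw [Finset.sum_range_succ'] at this
    linarith
  simp only [mul_sub, Finset.sum_sub_distrib, ← Finset.sum_mul] at hmain
  rw [hs1, hsum n] at hmain
  -- This is log convexity of `b` at `n`, written with its decrements.
  have hkey : g (n + 1) * b n ≤ g n * b (n + 1) := by
    simp only [hg]
    nlinarith [hlc n]
  have hfin : (g n * b 0) * w (n + 1) ≤ (g n * b 0) * w n := by
    have e1 : (g n * b 0) * w (n + 1) = g n * (g 0 * w n)
      + g n * ∑ k ∈ Finset.range n, g (k + 1) * w (n - 1 - k) - g n * (g (n + 1) / b 0) := by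
      rw [mul_assoc, hstep]; ring
    have e2 := mul_le_mul_of_nonneg_left hprev (hg0 (n + 1)).le
    have e3 := mul_le_mul_of_nonneg_right hkey (hw0' n)
    have e4 : g n * (g (n + 1) / b 0) = g (n + 1) * (g n / b 0) := by ring
    rw [e1, e4]
    rw [mul_sub] at e2
    nlinarith
  exact le_of_mul_le_mul_left hfin (mul_pos (hg0 n) (hb 0))

end Renewal

/-! ### Midpoint convexity and measures with convex density -/

/-- A midpoint convex function that is bounded above on intervals is convex: subtracting a chord,
the supremum `M` of the difference satisfies `M ≤ M / 2`. -/
theorem convexOn_of_midpoint {s : Set ℝ} (hs : Convex ℝ s) {f : ℝ → ℝ}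
    (hmid : ∀ x ∈ s, ∀ y ∈ s, f ((x + y) / 2) ≤ (f x + f y) / 2)
    (hbdd : ∀ x ∈ s, ∀ y ∈ s, BddAbove (f '' Icc x y)) : ConvexOn ℝ s f := by
  refine LinearOrder.convexOn_of_lt hs ?_
  intro x hx y hy hxy a b ha hb hab
  set g : ℝ → ℝ := fun t => f ((1 - t) * x + t * y) - ((1 - t) * f x + t * f y) with hg
  have hmem : ∀ t ∈ Icc (0 : ℝ) 1, (1 - t) * x + t * y ∈ s := fun t ht =>
    hs hx hy (by linarith [ht.2]) ht.1 (by ring)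
  have hgmid : ∀ t ∈ Icc (0 : ℝ) 1, ∀ r ∈ Icc (0 : ℝ) 1, g ((t + r) / 2) ≤ (g t + g r) / 2 := by
    intro t ht r hr
    have := hmid _ (hmem t ht) _ (hmem r hr)
    simp only [hg]
    rw [show (1 - (t + r) / 2) * x + (t + r) / 2 * y
      = ((1 - t) * x + t * y + ((1 - r) * x + r * y)) / 2 by ring]
    linarith
  have hbd : BddAbove (g '' Icc 0 1) := by
    obtain ⟨C, hC⟩ := hbdd x hx y hy
    refine ⟨C + (|f x| + |f y|), ?_⟩
    rintro _ ⟨t, ht, rfl⟩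
    have h1 : f ((1 - t) * x + t * y) ≤ C := hC ⟨_, ⟨by nlinarith [ht.1], by nlinarith [ht.2]⟩, rfl⟩
    have h2 : -((1 - t) * f x) ≤ |f x| := by
      nlinarith [neg_abs_le (f x), abs_nonneg (f x), ht.1, ht.2]
    have h3 : -(t * f y) ≤ |f y| := by
      nlinarith [neg_abs_le (f y), abs_nonneg (f y), ht.1, ht.2]
    simp only [hg]
    linarith
  have hg0 : g 0 = 0 := by simp [hg]
  have hg1 : g 1 = 0 := by simp [hg]
  set M := sSup (g '' Icc 0 1) with hM
  have hle : ∀ t ∈ Icc (0 : ℝ) 1, g t ≤ M := fun t ht => le_csSup hbd ⟨t, ht, rfl⟩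
  have hhalf : ∀ t ∈ Icc (0 : ℝ) 1, g t ≤ M / 2 := by
    intro t ht
    rcases le_total t (1 / 2) with h | h
    · have hm : (2 * t) ∈ Icc (0 : ℝ) 1 := ⟨by linarith [ht.1], by linarith⟩
      have := hgmid 0 (by simp) (2 * t) hm
      rw [hg0, show (0 + 2 * t) / 2 = t by ring] at this
      linarith [hle _ hm]
    · have hm : (2 * t - 1) ∈ Icc (0 : ℝ) 1 := ⟨by linarith, by linarith [ht.2]⟩
      have := hgmid 1 (by simp) (2 * t - 1) hm
      rw [hg1, show (1 + (2 * t - 1)) / 2 = t by ring] at this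
      linarith [hle _ hm]
  have hM0 : M ≤ M / 2 := csSup_le ⟨g 0, 0, by simp, rfl⟩
    (by rintro _ ⟨t, ht, rfl⟩; exact hhalf t ht)
  have := hle b ⟨hb.le, by linarith⟩
  simp only [hg, ← hab, add_sub_cancel_right] at this
  simp only [smul_eq_mul]
  linarith

/-- If the mass of intervals is non-increasing and convex under translation, the measure has a
non-increasing convex density on `(0, ∞)`, namely the right derivative of its distribution
function. -/
theorem exists_convex_density_of_translates {U : Measure ℝ} (hfin : ∀ b, U (Ioc 0 b) ≠ ∞)
    (h1 : ∀ a b s : ℝ, 0 < a → a < b → 0 < s →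
      U.real (Ioc (a + s) (b + s)) ≤ U.real (Ioc a b))
    (h2 : ∀ a b s : ℝ, 0 < a → a < b → 0 < s →
      2 * U.real (Ioc (a + s) (b + s)) ≤ U.real (Ioc a b) + U.real (Ioc (a + 2 * s) (b + 2 * s))) :
    ∃ u : ℝ → ℝ, (∀ x ∈ Ioi (0 : ℝ), 0 ≤ u x) ∧
      U.restrict (Ioi 0) = (volume.restrict (Ioi 0)).withDensity (fun x => ENNReal.ofReal (u x)) ∧
      AntitoneOn u (Ioi 0) ∧ ConvexOn ℝ (Ioi 0) u := by
  set F : ℝ → ℝ := fun x => U.real (Ioc 0 x) with hF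
  have hdiff : ∀ a b, 0 ≤ a → a ≤ b → U.real (Ioc a b) = F b - F a := by
    intro a b ha hab
    have hfin' : U (Ioc a b) ≠ ∞ := measure_ne_top_of_subset (Ioc_subset_Ioc_left ha) (hfin b)
    have : F b = F a + U.real (Ioc a b) := by
      simp only [hF]
      rw [← Ioc_union_Ioc_eq_Ioc ha hab,
        measureReal_union (Ioc_disjoint_Ioc_of_le le_rfl) measurableSet_Ioc (hfin a) hfin']
    linarith
  have hmono : MonotoneOn F (Ici 0) := by
    intro a ha b _ hab
    have := hdiff a b ha hab
    have := measureReal_nonneg (μ := U) (s := Ioc a b)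
    linarith
  have hconc : ConcaveOn ℝ (Ioi 0) F := by
    rw [← neg_convexOn_iff]
    have key : ∀ x y : ℝ, 0 < x → x ≤ y → (-F) ((x + y) / 2) ≤ ((-F) x + (-F) y) / 2 := by
      intro x y hx hxy
      simp only [Pi.neg_apply]
      rcases hxy.eq_or_lt with rfl | hxy
      · simp
      have := h1 x ((x + y) / 2) ((y - x) / 2) hx (by linarith) (by linarith)
      rw [hdiff _ _ hx.le (by linarith), hdiff _ _ (by linarith) (by linarith),
        show x + (y - x) / 2 = (x + y) / 2 by ring,
        show (x + y) / 2 + (y - x) / 2 = y by ring] at this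
      linarith
    refine convexOn_of_midpoint (convex_Ioi 0) ?_ ?_
    · intro x hx y hy
      rcases le_total x y with h | h
      · exact key x y hx h
      · rw [add_comm x, add_comm ((-F) x)]; exact key y x hy h
    · intro x _ y _
      refine ⟨0, ?_⟩
      rintro _ ⟨t, _, rfl⟩
      simp [hF]
  have hE : ∀ s, 0 < s → ConvexOn ℝ (Ioi 0) (fun x => F (x + s) - F x) := by
    intro s hs
    have hanti : ∀ x y : ℝ, 0 < x → x ≤ y → F (y + s) - F y ≤ F (x + s) - F x := by
      intro x y hx hxy
      rcases hxy.eq_or_lt with rfl | hxy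
      · simp
      have := h1 x (x + s) (y - x) hx (by linarith) (by linarith)
      rw [hdiff _ _ hx.le (by linarith), hdiff _ _ (by linarith) (by linarith),
        show x + (y - x) = y by ring, show x + s + (y - x) = y + s by ring] at this
      exact this
    have key : ∀ x y : ℝ, 0 < x → x ≤ y → F ((x + y) / 2 + s) - F ((x + y) / 2)
        ≤ ((F (x + s) - F x) + (F (y + s) - F y)) / 2 := by
      intro x y hx hxy
      rcases hxy.eq_or_lt with rfl | hxy
      · simp
      have := h2 x (x + s) ((y - x) / 2) hx (by linarith) (by linarith)
      rw [hdiff _ _ hx.le (by linarith), hdiff _ _ (by linarith) (by linarith),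
        hdiff _ _ (by linarith) (by linarith),
        show x + (y - x) / 2 = (x + y) / 2 by ring,
        show x + s + (y - x) / 2 = (x + y) / 2 + s by ring,
        show x + s + 2 * ((y - x) / 2) = y + s by ring,
        show x + 2 * ((y - x) / 2) = y by ring] at this
      linarith
    refine convexOn_of_midpoint (convex_Ioi 0) ?_ ?_
    · intro x hx y hy
      rcases le_total x y with h | h
      · exact key x y hx h
      · rw [add_comm x, add_comm (F (x + s) - F x)]; exact key y x hy h
    · intro x hx y _
      refine ⟨F (x + s) - F x, ?_⟩
      rintro _ ⟨t, ht, rfl⟩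
      exact hanti x t hx ht.1
  set u : ℝ → ℝ := fun x => derivWithin F (Ioi x) x with hu
  have hder : ∀ x ∈ Ioi (0 : ℝ), HasDerivWithinAt F (u x) (Ioi x) x := by
    intro x hx
    have h := (neg_convexOn_iff.2 hconc).differentiableWithinAt_Ioi_of_mem_interior
      (by rwa [interior_Ioi] : x ∈ interior (Ioi 0))
    have := h.neg
    rw [neg_neg] at this
    exact this.hasDerivWithinAt
  have hlim : ∀ x ∈ Ioi (0 : ℝ),
      Tendsto (fun s => s⁻¹ * (F (x + s) - F x)) (𝓝[>] 0) (𝓝 (u x)) := by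
    intro x hx
    have h := (hasDerivWithinAt_iff_tendsto_slope' (by simp)).1 (hder x hx)
    have hshift : Tendsto (fun s : ℝ => x + s) (𝓝[>] 0) (𝓝[>] x) := by
      refine tendsto_nhdsWithin_iff.2 ⟨?_, ?_⟩
      · have : Tendsto (fun s : ℝ => x + s) (𝓝 0) (𝓝 (x + 0)) := tendsto_const_nhds.add tendsto_id
        rw [add_zero] at this
        exact this.mono_left nhdsWithin_le_nhds
      · filter_upwards [self_mem_nhdsWithin] with s hs
        exact lt_add_of_pos_right x hs
    refine (h.comp hshift).congr fun s => ?_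
    simp [slope_def_field, div_eq_inv_mul]
  have hu0 : ∀ x ∈ Ioi (0 : ℝ), 0 ≤ u x := by
    intro x hx
    have hx' : (0 : ℝ) < x := hx
    refine ge_of_tendsto (hlim x hx) ?_
    filter_upwards [self_mem_nhdsWithin] with s hs
    have hs' : (0 : ℝ) < s := hs
    refine mul_nonneg (inv_nonneg.2 hs'.le) (sub_nonneg.2 (hmono hx'.le ?_ ?_))
    · exact (add_pos hx' hs').le
    · linarith
  have huanti : AntitoneOn u (Ioi 0) := by
    intro x hx y hy hxy
    have hx' : (0 : ℝ) < x := hx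
    refine le_of_tendsto_of_tendsto (hlim y hy) (hlim x hx) ?_
    filter_upwards [self_mem_nhdsWithin] with s hs
    have hs' : (0 : ℝ) < s := hs
    refine mul_le_mul_of_nonneg_left ?_ (inv_nonneg.2 hs'.le)
    rcases hxy.eq_or_lt with rfl | hxy
    · simp
    have := h1 x (x + s) (y - x) hx (by linarith) (by linarith)
    rw [hdiff _ _ hx'.le (by linarith), hdiff _ _ (by linarith) (by linarith),
      show x + (y - x) = y by ring, show x + s + (y - x) = y + s by ring] at this
    exact this
  have hucvx : ConvexOn ℝ (Ioi 0) u := by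
    refine ⟨convex_Ioi 0, ?_⟩
    intro x hx y hy a b ha hb hab
    refine le_of_tendsto_of_tendsto (hlim _ (convex_Ioi (0 : ℝ) hx hy ha hb hab))
      (((hlim x hx).const_smul a).add ((hlim y hy).const_smul b)) ?_
    filter_upwards [self_mem_nhdsWithin] with s hs
    have hs' : (0 : ℝ) < s := hs
    have := mul_le_mul_of_nonneg_left ((hE s hs').2 hx hy ha hb hab) (inv_nonneg.2 hs'.le)
    refine this.trans (le_of_eq ?_)
    simp only [smul_eq_mul]
    ring
  have hFcont : ContinuousOn F (Ioi 0) := hconc.continuousOn isOpen_Ioi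
  have hftc : ∀ a b, 0 < a → a ≤ b → U (Ioc a b) = ∫⁻ x in Ioc a b, ENNReal.ofReal (u x) := by
    intro a b ha hab
    have hsub : Icc a b ⊆ Ioi 0 := fun x hx => ha.trans_le hx.1
    have hint : IntervalIntegrable u volume a b :=
      (huanti.mono (by rwa [uIcc_of_le hab])).intervalIntegrable
    have h := intervalIntegral.integral_eq_sub_of_hasDeriv_right_of_le hab (hFcont.mono hsub)
      (fun x hx => hder x (hsub (Ioo_subset_Icc_self hx))) hint
    rw [← hdiff a b ha.le hab, intervalIntegral.integral_of_le hab] at h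
    rw [← ofReal_integral_eq_lintegral_ofReal
      ((intervalIntegrable_iff_integrableOn_Ioc_of_le hab).1 hint), h,
      ofReal_measureReal (measure_ne_top_of_subset (Ioc_subset_Ioc_left ha.le) (hfin b))]
    filter_upwards [ae_restrict_mem measurableSet_Ioc] with x hx
    exact hu0 x (ha.trans hx.1)
  refine ⟨u, hu0, ?_, huanti, hucvx⟩
  rw [← restrict_withDensity measurableSet_Ioi]
  have hcover : Ioi (0 : ℝ) = ⋃ n : ℕ, Ioi (1 / ((n : ℝ) + 1)) := by
    ext x
    simp only [mem_Ioi, mem_iUnion]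
    exact ⟨fun hx => exists_nat_one_div_lt hx, fun ⟨n, hn⟩ => lt_trans (by positivity) hn⟩
  rw [hcover, Measure.restrict_iUnion_congr]
  intro n
  have hδ : 0 < 1 / ((n : ℝ) + 1) := by positivity
  set δ := 1 / ((n : ℝ) + 1)
  have hset : ∀ a b, Ioc a b ∩ Ioi δ = Ioc (max a δ) b := by
    intro a b
    ext x
    simp only [mem_inter_iff, mem_Ioc, mem_Ioi, max_lt_iff]
    tauto
  have hmax : ∀ a, 0 < max a δ := fun a => lt_max_of_lt_right hδ
  refine Measure.ext_of_Ioc' _ _ ?_ ?_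
  · intro a b _
    rw [Measure.restrict_apply measurableSet_Ioc, hset]
    exact measure_ne_top_of_subset (Ioc_subset_Ioc_left (hmax a).le) (hfin b)
  · intro a b _
    rw [Measure.restrict_apply measurableSet_Ioc, Measure.restrict_apply measurableSet_Ioc, hset]
    rcases le_total (max a δ) b with h | h
    · rw [withDensity_apply _ measurableSet_Ioc, hftc _ _ (hmax a) h]
    · simp [Ioc_eq_empty (not_lt.2 h)]

/-! ### Laplace transforms and vague convergence -/

/-- The Laplace transform `∫ exp (-θ x) μ(dx)` of a measure, with values in `[0, ∞]`. -/
noncomputable def laplaceTransform (μ : Measure ℝ) (θ : ℝ) : ℝ≥0∞ :=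
  ∫⁻ x, ENNReal.ofReal (Real.exp (-θ * x)) ∂μ

section Laplace

variable {μ : Measure ℝ}

theorem ae_nonneg_of_measure_Iio_eq_zero (h : μ (Iio 0) = 0) : ∀ᵐ x ∂μ, 0 ≤ x := by
  rw [ae_iff]
  simpa [Iio, ofPred] using h

theorem integrable_exp_neg {θ : ℝ} (h : laplaceTransform μ θ ≠ ∞) :
    Integrable (fun x => Real.exp (-θ * x)) μ := by
  refine ⟨by fun_prop, ?_⟩
  rw [hasFiniteIntegral_iff_ofReal (ae_of_all _ fun x => (Real.exp_pos _).le)]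
  exact h.lt_top

theorem integral_exp_neg (θ : ℝ) :
    ∫ x, Real.exp (-θ * x) ∂μ = (laplaceTransform μ θ).toReal := by
  rw [integral_eq_lintegral_of_nonneg_ae (ae_of_all _ fun x => (Real.exp_pos _).le) (by fun_prop)]
  rfl

theorem laplaceTransform_anti (h0 : μ (Iio 0) = 0) {θ η : ℝ} (h : θ ≤ η) :
    laplaceTransform μ η ≤ laplaceTransform μ θ := by
  refine lintegral_mono_ae ?_
  filter_upwards [ae_nonneg_of_measure_Iio_eq_zero h0] with x hx
  exact ENNReal.ofReal_le_ofReal (Real.exp_le_exp.2 (by nlinarith))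

theorem measure_Ioc_ne_top (h1 : laplaceTransform μ 1 ≠ ∞) (a b : ℝ) : μ (Ioc a b) ≠ ∞ := by
  have h : ENNReal.ofReal (Real.exp (-b)) * μ (Ioc a b) ≤ laplaceTransform μ 1 := by
    rw [← setLIntegral_const]
    refine (setLIntegral_mono' measurableSet_Ioc fun x hx => ?_).trans
      (setLIntegral_le_lintegral _ _)
    exact ENNReal.ofReal_le_ofReal (Real.exp_le_exp.2 (by linarith [hx.2]))
  have hpos : ENNReal.ofReal (Real.exp (-b)) ≠ 0 := by
    simpa using Real.exp_pos (-b)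
  intro htop
  rw [htop, ENNReal.mul_top hpos] at h
  exact h1 (top_le_iff.1 h)

end Laplace

/-- At `z = 0`, where the formula gives the junk value `0`, the function is continuous because
`F (-log z) = 0` for small `z`. -/
theorem continuousOn_comp_neg_log_div {F : ℝ → ℝ} (hF : Continuous F) (hc : HasCompactSupport F) :
    ContinuousOn (fun z => F (-Real.log z) / z) (Icc 0 1) := by
  obtain ⟨R, hR⟩ := hc.isCompact.isBounded.subset_closedBall 0
  have hzero : ∀ x, R < x → F x = 0 := by
    intro x hx
    refine image_eq_zero_of_notMem_tsupport fun hmem => ?_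
    have := hR hmem
    rw [Metric.mem_closedBall, Real.dist_eq, sub_zero] at this
    linarith [le_abs_self x]
  intro z hz
  rcases hz.1.eq_or_lt with rfl | hz0
  · have hev : (fun z => F (-Real.log z) / z) =ᶠ[𝓝[Icc 0 1] 0] fun _ => 0 := by
      filter_upwards [self_mem_nhdsWithin,
        mem_nhdsWithin_of_mem_nhds (Iio_mem_nhds (Real.exp_pos (-R)))] with y hy hy'
      rcases hy.1.eq_or_lt with rfl | hy0
      · simp
      · have : Real.log y < -R := (Real.log_lt_iff_lt_exp hy0).2 hy'
        rw [hzero _ (by linarith), zero_div]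
    exact (continuousWithinAt_const (b := (0 : ℝ))).congr_of_eventuallyEq hev (by simp)
  · refine ContinuousAt.continuousWithinAt ?_
    exact (hF.continuousAt.comp (Real.continuousAt_log hz0.ne').neg).div continuousAt_id hz0.ne'

/-- In the variable `z = exp (-x)`, `F` is `exp (-x)` times a function of `z` that is continuous on
`[0, 1]` when `F` has compact support. -/
theorem apply_eq_exp_neg_mul (F : ℝ → ℝ) (x : ℝ) :
    F x = Real.exp (-x) * (F (-Real.log (Real.exp (-x))) / Real.exp (-x)) := by
  rw [Real.log_exp, neg_neg, mul_div_cancel₀ _ (Real.exp_pos _).ne']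

theorem exp_neg_mem_Icc {x : ℝ} (hx : 0 ≤ x) : Real.exp (-x) ∈ Icc (0 : ℝ) 1 :=
  ⟨(Real.exp_pos _).le, Real.exp_le_one_iff.2 (by linarith)⟩

theorem integrable_of_laplaceTransform_ne_top {ρ : Measure ℝ} (h0 : ρ (Iio 0) = 0)
    (h1 : laplaceTransform ρ 1 ≠ ∞) {F : ℝ → ℝ} (hF : Continuous F) (hc : HasCompactSupport F) :
    Integrable F ρ := by
  obtain ⟨C, hC⟩ := isCompact_Icc.exists_bound_of_continuousOn (continuousOn_comp_neg_log_div hF hc)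
  have hexp : Integrable (fun x => Real.exp (-x)) ρ := by simpa using integrable_exp_neg h1
  refine (hexp.const_mul C).mono' (by fun_prop) ?_
  filter_upwards [ae_nonneg_of_measure_Iio_eq_zero h0] with x hx
  rw [apply_eq_exp_neg_mul F x, norm_mul, Real.norm_of_nonneg (Real.exp_pos _).le, mul_comm C]
  exact mul_le_mul_of_nonneg_left (hC _ (exp_neg_mem_Icc hx)) (Real.exp_pos _).le

/-- Convergence of Laplace transforms on the positive integers implies vague convergence, because
by the Weierstrass theorem the functions `exp (-x) * p (exp (-x))`, with `p` a polynomial,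
approximate every compactly supported function uniformly relative to `exp (-x)`. -/
theorem tendsto_integral_of_tendsto_laplaceTransform {ι : Type*} {l : Filter ι}
    {μ : ι → Measure ℝ} {ν : Measure ℝ} (hμ0 : ∀ i, μ i (Iio 0) = 0) (hν0 : ν (Iio 0) = 0)
    (hμ1 : ∀ i, laplaceTransform (μ i) 1 ≠ ∞) (hν1 : laplaceTransform ν 1 ≠ ∞)
    (hlim : ∀ k : ℕ, Tendsto (fun i => laplaceTransform (μ i) (k + 1)) l
      (𝓝 (laplaceTransform ν (k + 1))))
    {F : ℝ → ℝ} (hF : Continuous F) (hc : HasCompactSupport F) :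
    Tendsto (fun i => ∫ x, F x ∂μ i) l (𝓝 (∫ x, F x ∂ν)) := by
  have hfin : ∀ (ρ : Measure ℝ), ρ (Iio 0) = 0 → laplaceTransform ρ 1 ≠ ∞ → ∀ k : ℕ,
      laplaceTransform ρ (k + 1) ≠ ∞ := fun ρ h0 h1 k =>
    ne_top_of_le_ne_top h1 (laplaceTransform_anti h0 (by simp))
  have hGc := continuousOn_comp_neg_log_div hF hc
  have hexp1 : ∀ ρ : Measure ℝ, laplaceTransform ρ 1 ≠ ∞ →
      Integrable (fun x => Real.exp (-x)) ρ := fun ρ h1 => by simpa using integrable_exp_neg h1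
  have hFint : ∀ ρ : Measure ℝ, ρ (Iio 0) = 0 → laplaceTransform ρ 1 ≠ ∞ → Integrable F ρ :=
    fun ρ h0 h1 => integrable_of_laplaceTransform_ne_top h0 h1 hF hc
  -- integrals of `exp (-x) * p (exp (-x))`
  have hpoly : ∀ (p : Polynomial ℝ) (x : ℝ), Real.exp (-x) * p.eval (Real.exp (-x))
      = ∑ k ∈ Finset.range (p.natDegree + 1), p.coeff k * Real.exp (-((k : ℝ) + 1) * x) := by
    intro p x
    rw [Polynomial.eval_eq_sum_range, Finset.mul_sum]
    refine Finset.sum_congr rfl fun k _ => ?_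
    rw [← Real.exp_nat_mul, mul_left_comm, ← Real.exp_add]
    ring_nf
  have hpint : ∀ (p : Polynomial ℝ) (ρ : Measure ℝ), ρ (Iio 0) = 0 → laplaceTransform ρ 1 ≠ ∞ →
      Integrable (fun x => Real.exp (-x) * p.eval (Real.exp (-x))) ρ := by
    intro p ρ h0 h1
    simp_rw [hpoly]
    exact integrable_finsetSum _ fun k _ => (integrable_exp_neg (hfin ρ h0 h1 k)).const_mul _
  have hpval : ∀ (p : Polynomial ℝ) (ρ : Measure ℝ), ρ (Iio 0) = 0 → laplaceTransform ρ 1 ≠ ∞ →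
      ∫ x, Real.exp (-x) * p.eval (Real.exp (-x)) ∂ρ = ∑ k ∈ Finset.range (p.natDegree + 1),
        p.coeff k * (laplaceTransform ρ (k + 1)).toReal := by
    intro p ρ h0 h1
    simp_rw [hpoly]
    rw [integral_finsetSum _ fun k _ => (integrable_exp_neg (hfin ρ h0 h1 k)).const_mul _]
    refine Finset.sum_congr rfl fun k _ => ?_
    rw [integral_const_mul, integral_exp_neg]
  have happ : ∀ (p : Polynomial ℝ) (ε : ℝ),
      (∀ z ∈ Icc (0 : ℝ) 1, |p.eval z - F (-Real.log z) / z| < ε) →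
      ∀ ρ : Measure ℝ, ρ (Iio 0) = 0 → laplaceTransform ρ 1 ≠ ∞ →
      |∫ x, Real.exp (-x) * p.eval (Real.exp (-x)) ∂ρ - ∫ x, F x ∂ρ|
        ≤ ε * (laplaceTransform ρ 1).toReal := by
    intro p ε hp ρ h0 h1
    rw [← integral_sub (hpint p ρ h0 h1) (hFint ρ h0 h1), ← integral_exp_neg]
    simp only [neg_mul, one_mul]
    rw [← integral_const_mul, ← Real.norm_eq_abs]
    refine norm_integral_le_of_norm_le ((hexp1 ρ h1).const_mul ε) ?_
    filter_upwards [ae_nonneg_of_measure_Iio_eq_zero h0] with x hx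
    rw [apply_eq_exp_neg_mul F x, ← mul_sub, norm_mul, Real.norm_of_nonneg (Real.exp_pos _).le,
      mul_comm ε]
    exact mul_le_mul_of_nonneg_left (hp _ (exp_neg_mem_Icc hx)).le (Real.exp_pos _).le
  have hlim' : ∀ k : ℕ, Tendsto (fun i => (laplaceTransform (μ i) (k + 1)).toReal) l
      (𝓝 (laplaceTransform ν (k + 1)).toReal) := fun k =>
    (ENNReal.tendsto_toReal (hfin ν hν0 hν1 k)).comp (hlim k)
  rw [Metric.tendsto_nhds]
  intro ε hε
  set L := (laplaceTransform ν 1).toReal with hL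
  have hL0 : 0 ≤ L := ENNReal.toReal_nonneg
  set δ := ε / (3 * (L + 1)) with hδ
  have hδ0 : 0 < δ := by positivity
  have hδL : δ * (L + 1) = ε / 3 := by
    rw [hδ]; field_simp
  obtain ⟨p, hp⟩ := exists_polynomial_near_of_continuousOn 0 1 _ hGc δ hδ0
  have hconv : Tendsto (fun i => ∫ x, Real.exp (-x) * p.eval (Real.exp (-x)) ∂μ i) l
      (𝓝 (∫ x, Real.exp (-x) * p.eval (Real.exp (-x)) ∂ν)) := by
    rw [hpval p ν hν0 hν1]
    simp_rw [fun i => hpval p (μ i) (hμ0 i) (hμ1 i)]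
    exact tendsto_finsetSum _ fun k _ => (hlim' k).const_mul _
  have hL1 : ∀ᶠ i in l, (laplaceTransform (μ i) 1).toReal < L + 1 := by
    have := hlim' 0
    simp only [Nat.cast_zero, zero_add] at this
    exact this.eventually (gt_mem_nhds (by linarith))
  filter_upwards [hL1, Metric.tendsto_nhds.1 hconv (ε / 3) (by positivity)] with i hi hi'
  have a1 := happ p δ hp (μ i) (hμ0 i) (hμ1 i)
  have a2 := happ p δ hp ν hν0 hν1
  rw [Real.dist_eq] at hi' ⊢
  have b1 : δ * (laplaceTransform (μ i) 1).toReal ≤ ε / 3 := by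
    rw [← hδL]; exact mul_le_mul_of_nonneg_left hi.le hδ0.le
  have b2 : δ * (laplaceTransform ν 1).toReal ≤ ε / 3 := by
    rw [← hδL]; exact mul_le_mul_of_nonneg_left (by linarith) hδ0.le
  have a1' := abs_le.1 (a1.trans b1)
  have a2' := abs_le.1 (a2.trans b2)
  have hi'' := abs_lt.1 hi'
  rw [abs_lt]
  constructor <;> linarith [a1'.1, a1'.2, a2'.1, a2'.2, hi''.1, hi''.2]

/-- Continuous functions with values in `[0, 1]` that converge pointwise to the indicator function
of `(a, b]`: trapezia that vanish outside `(a, b + 1)`. -/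
noncomputable def trapezium (a b : ℝ) (n : ℕ) (x : ℝ) : ℝ :=
  max 0 (min 1 (min ((n + 1) * (x - a)) (1 + (n + 1) * (b - x))))

section Trapezium

variable {a b : ℝ} (n : ℕ)

theorem continuous_trapezium : Continuous (trapezium a b n) := by
  unfold trapezium
  fun_prop

theorem trapezium_nonneg (x : ℝ) : 0 ≤ trapezium a b n x := le_max_left _ _

theorem trapezium_eq_zero_of_le {x : ℝ} (hx : x ≤ a) : trapezium a b n x = 0 := by
  refine max_eq_left ((min_le_right _ _).trans ((min_le_left _ _).trans ?_))
  exact mul_nonpos_of_nonneg_of_nonpos (by positivity) (by linarith)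

theorem trapezium_eq_zero_of_ge {x : ℝ} (hx : b + 1 ≤ x) : trapezium a b n x = 0 := by
  refine max_eq_left ((min_le_right _ _).trans ((min_le_right _ _).trans ?_))
  nlinarith [(Nat.cast_nonneg n : (0 : ℝ) ≤ n)]

theorem trapezium_le_indicator (x : ℝ) :
    trapezium a b n x ≤ (Ioc a (b + 1)).indicator 1 x := by
  by_cases h : x ∈ Ioc a (b + 1)
  · rw [indicator_of_mem h]
    exact max_le zero_le_one (min_le_left _ _)
  · rw [indicator_of_notMem h]
    rw [mem_Ioc, not_and_or, not_lt, not_le] at h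
    rcases h with h | h
    · exact (trapezium_eq_zero_of_le n h).le
    · exact (trapezium_eq_zero_of_ge n h.le).le

theorem hasCompactSupport_trapezium : HasCompactSupport (trapezium a b n) := by
  refine HasCompactSupport.intro (isCompact_Icc (a := a) (b := b + 1)) fun x hx => ?_
  rw [mem_Icc, not_and_or, not_le, not_le] at hx
  rcases hx with h | h
  · exact trapezium_eq_zero_of_le n h.le
  · exact trapezium_eq_zero_of_ge n h.le

theorem tendsto_trapezium (x : ℝ) :
    Tendsto (fun n => trapezium a b n x) atTop (𝓝 ((Ioc a b).indicator 1 x)) := by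
  have hlin : ∀ c : ℝ, 0 < c → ∀ᶠ n : ℕ in atTop, 1 ≤ ((n : ℝ) + 1) * c := by
    intro c hc
    have : Tendsto (fun n : ℕ => ((n : ℝ) + 1) * c) atTop atTop :=
      (tendsto_atTop_add_const_right _ _ tendsto_natCast_atTop_atTop).atTop_mul_const hc
    exact this.eventually_ge_atTop 1
  by_cases h : x ∈ Ioc a b
  · rw [indicator_of_mem h]
    refine tendsto_const_nhds.congr' ?_
    filter_upwards [hlin (x - a) (sub_pos.2 h.1)] with n hn
    have : 0 ≤ ((n : ℝ) + 1) * (b - x) := mul_nonneg (by positivity) (sub_nonneg.2 h.2)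
    rw [trapezium, min_eq_left (le_min hn (by linarith)), max_eq_right zero_le_one, Pi.one_apply]
  · rw [indicator_of_notMem h]
    refine tendsto_const_nhds.congr' ?_
    rw [mem_Ioc, not_and_or, not_lt, not_le] at h
    rcases h with h | h
    · exact Eventually.of_forall fun n => (trapezium_eq_zero_of_le n h).symm
    · filter_upwards [hlin (x - b) (sub_pos.2 h)] with n hn
      symm
      refine max_eq_left ((min_le_right _ _).trans ((min_le_right _ _).trans ?_))
      have : ((n : ℝ) + 1) * (b - x) = -(((n : ℝ) + 1) * (x - b)) := by ring
      linarith

theorem tendsto_integral_trapezium {ν : Measure ℝ} (hν : ν (Ioc a (b + 1)) ≠ ∞) :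
    Tendsto (fun n => ∫ x, trapezium a b n x ∂ν) atTop (𝓝 (ν.real (Ioc a b))) := by
  rw [← integral_indicator_one measurableSet_Ioc]
  refine tendsto_integral_of_dominated_convergence ((Ioc a (b + 1)).indicator 1)
    (fun n => (continuous_trapezium n).aestronglyMeasurable) ?_ (fun n => ae_of_all _ fun x => ?_)
    (ae_of_all _ fun x => tendsto_trapezium x)
  · exact (integrable_indicator_iff measurableSet_Ioc).2 (integrableOn_const hν)
  · rw [Real.norm_of_nonneg (trapezium_nonneg n x)]
    exact trapezium_le_indicator n x

end Trapezium

/-- A measure on `[0, ∞)` is determined by the values of its Laplace transform at positive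
integers. -/
theorem measure_ext_of_laplaceTransform {μ ν : Measure ℝ} (hμ0 : μ (Iio 0) = 0)
    (hν0 : ν (Iio 0) = 0) (hν1 : laplaceTransform ν 1 ≠ ∞)
    (h : ∀ k : ℕ, laplaceTransform μ (k + 1) = laplaceTransform ν (k + 1)) : μ = ν := by
  have hμ1 : laplaceTransform μ 1 ≠ ∞ := by
    have := h 0
    simp only [Nat.cast_zero, zero_add] at this
    rwa [this]
  have hint : ∀ F : ℝ → ℝ, Continuous F → HasCompactSupport F →
      ∫ x, F x ∂μ = ∫ x, F x ∂ν := by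
    intro F hF hc
    have := tendsto_integral_of_tendsto_laplaceTransform (ι := ℕ) (l := atTop) (μ := fun _ => μ)
      (ν := ν) (fun _ => hμ0) hν0 (fun _ => hμ1) hν1
      (fun k => by rw [h k]; exact tendsto_const_nhds) hF hc
    exact tendsto_nhds_unique tendsto_const_nhds this
  refine Measure.ext_of_Ioc' _ _ (fun a b _ => measure_Ioc_ne_top hμ1 a b) fun a b _ => ?_
  have h1 := tendsto_integral_trapezium (measure_Ioc_ne_top hμ1 a (b + 1))
  have h2 := tendsto_integral_trapezium (measure_Ioc_ne_top hν1 a (b + 1))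
  simp_rw [fun n => hint _ (continuous_trapezium (a := a) (b := b) n)
    (hasCompactSupport_trapezium n)] at h1
  have := tendsto_nhds_unique h1 h2
  exact (measureReal_eq_measureReal_iff (measure_Ioc_ne_top hμ1 a b)
    (measure_Ioc_ne_top hν1 a b)).1 this

/-! ### Log convex Lévy densities and their Laplace exponents -/

section LevyDensity

variable {Υ : ℝ → ℝ}

theorem LogConvexOn.continuousOn (hlog : LogConvexOn (Ioi 0) Υ) : ContinuousOn Υ (Ioi 0) :=
  ((hlog.2.continuousOn isOpen_Ioi).rexp).congr fun x hx => (Real.exp_log (hlog.1 x hx)).symm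

theorem LogConvexOn.aestronglyMeasurable (hlog : LogConvexOn (Ioi 0) Υ) :
    AEStronglyMeasurable Υ (volume.restrict (Ioi 0)) :=
  hlog.continuousOn.aestronglyMeasurable measurableSet_Ioi

theorem LogConvexOn.sq_le (hlog : LogConvexOn (Ioi 0) Υ) {x s : ℝ} (hx : 0 < x) (hs : 0 ≤ s) :
    Υ (x + s) ^ 2 ≤ Υ x * Υ (x + 2 * s) := by
  have h1 : x + s ∈ Ioi (0 : ℝ) := add_pos_of_pos_of_nonneg hx hs
  have h2 : x + 2 * s ∈ Ioi (0 : ℝ) := add_pos_of_pos_of_nonneg hx (by positivity)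
  have hx' : x ∈ Ioi (0 : ℝ) := hx
  have h := hlog.2.2 hx' h2 (by norm_num : (0 : ℝ) ≤ 1 / 2) (by norm_num : (0 : ℝ) ≤ 1 / 2)
    (by norm_num)
  simp only [smul_eq_mul] at h
  rw [show 1 / 2 * x + 1 / 2 * (x + 2 * s) = x + s by ring] at h
  rw [← Real.log_le_log_iff (pow_pos (hlog.1 _ h1) 2) (mul_pos (hlog.1 _ hx') (hlog.1 _ h2)),
    Real.log_pow, Real.log_mul (hlog.1 _ hx').ne' (hlog.1 _ h2).ne']
  push_cast
  linarith

theorem LogConvexOn.integrableOn_Ioi (hlog : LogConvexOn (Ioi 0) Υ)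
    (hint : IntegrableOn (fun x => min 1 x * Υ x) (Ioi 0)) {a : ℝ} (ha : 0 < a) :
    IntegrableOn Υ (Ioi a) := by
  have hsub : Ioi a ⊆ Ioi 0 := Ioi_subset_Ioi ha.le
  have hmin : 0 < min 1 a := lt_min one_pos ha
  refine ((hint.mono_set hsub).const_mul (min 1 a)⁻¹).mono'
    (hlog.aestronglyMeasurable.mono_measure (Measure.restrict_mono hsub le_rfl)) ?_
  filter_upwards [ae_restrict_mem measurableSet_Ioi] with x hx
  have hΥ := hlog.1 x (hsub hx)
  rw [Real.norm_of_nonneg hΥ.le, ← mul_assoc]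
  refine le_mul_of_one_le_left hΥ.le ?_
  rw [← div_eq_inv_mul, one_le_div hmin]
  exact min_le_min le_rfl (le_of_lt hx)

/-- A log convex function that increases somewhere stays above a positive constant from there on,
so it is not integrable at infinity. -/
theorem LogConvexOn.antitoneOn (hlog : LogConvexOn (Ioi 0) Υ)
    (hint : IntegrableOn (fun x => min 1 x * Υ x) (Ioi 0)) : AntitoneOn Υ (Ioi 0) := by
  intro x hx y hy hxy
  by_contra! hlt
  have hx0 : (0 : ℝ) < x := hx
  have hxy' : x < y := lt_of_le_of_ne hxy (by rintro rfl; exact lt_irrefl _ hlt)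
  have hge : ∀ z ∈ Ioi y, Υ y ≤ Υ z := by
    intro z hz
    have hz0 : z ∈ Ioi (0 : ℝ) := (show (0 : ℝ) < y from hy).trans hz
    rw [← Real.log_le_log_iff (hlog.1 y hy) (hlog.1 z hz0)]
    have hmem : y ∈ openSegment ℝ x z := by
      rw [openSegment_eq_Ioo (hxy'.trans hz)]; exact ⟨hxy', hz⟩
    exact hlog.2.le_right_of_left_le hx hz0 hmem (Real.log_le_log (hlog.1 x hx) hlt.le)
  have hconst : IntegrableOn (fun _ => Υ y) (Ioi y) := by
    refine (hlog.integrableOn_Ioi hint hy).mono' aestronglyMeasurable_const ?_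
    filter_upwards [ae_restrict_mem measurableSet_Ioi] with z hz
    rw [Real.norm_of_nonneg (hlog.1 y hy).le]
    exact hge z hz
  rw [integrableOn_const_iff] at hconst
  rcases hconst with h | h
  · exact (hlog.1 y hy).ne' (by simpa using h)
  · simp at h

theorem one_sub_exp_nonneg {θ x : ℝ} (hθ : 0 ≤ θ) (hx : 0 ≤ x) : 0 ≤ 1 - Real.exp (-θ * x) :=
  sub_nonneg.2 (Real.exp_le_one_iff.2 (by nlinarith))

theorem LogConvexOn.integrableOn_one_sub_exp (hlog : LogConvexOn (Ioi 0) Υ)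
    (hint : IntegrableOn (fun x => min 1 x * Υ x) (Ioi 0)) {θ : ℝ} (hθ : 0 ≤ θ) :
    IntegrableOn (fun x => (1 - Real.exp (-θ * x)) * Υ x) (Ioi 0) := by
  refine (hint.const_mul (max 1 θ)).mono'
    ((Continuous.aestronglyMeasurable (by fun_prop)).mul hlog.aestronglyMeasurable) ?_
  filter_upwards [ae_restrict_mem measurableSet_Ioi] with x hx
  have hx0 : (0 : ℝ) < x := hx
  have hΥ := hlog.1 x hx
  rw [norm_mul, Real.norm_of_nonneg (one_sub_exp_nonneg hθ hx0.le), Real.norm_of_nonneg hΥ.le,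
    ← mul_assoc]
  refine mul_le_mul_of_nonneg_right ?_ hΥ.le
  rcases le_total 1 x with h | h
  · rw [min_eq_left h, mul_one]
    exact le_trans (by linarith [Real.exp_pos (-θ * x)]) (le_max_left _ _)
  · rw [min_eq_right h]
    refine le_trans ?_ (mul_le_mul_of_nonneg_right (le_max_right _ _) hx0.le)
    linarith [Real.add_one_le_exp (-θ * x)]

/-- The Laplace exponent of a subordinator with killing rate `κ`, drift `d` and Lévy density
`Υ`. -/
noncomputable def laplaceExponent (κ d : ℝ) (Υ : ℝ → ℝ) (θ : ℝ) : ℝ :=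
  κ + d * θ + ∫ x in Ioi (0 : ℝ), (1 - Real.exp (-θ * x)) * Υ x

theorem LogConvexOn.laplaceExponent_pos (hlog : LogConvexOn (Ioi 0) Υ)
    (hint : IntegrableOn (fun x => min 1 x * Υ x) (Ioi 0)) {κ d θ : ℝ} (hκ : 0 ≤ κ) (hd : 0 ≤ d)
    (hθ : 0 < θ) : 0 < laplaceExponent κ d Υ θ := by
  have hpos : ∀ x ∈ Ioi (0 : ℝ), 0 < (1 - Real.exp (-θ * x)) * Υ x := by
    intro x hx
    have hx0 : (0 : ℝ) < x := hx
    refine mul_pos (sub_pos.2 (Real.exp_lt_one_iff.2 ?_)) (hlog.1 x hx)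
    nlinarith
  have : 0 < ∫ x in Ioi (0 : ℝ), (1 - Real.exp (-θ * x)) * Υ x := by
    rw [setIntegral_pos_iff_support_of_nonneg_ae]
    · have hsub : Ioi (0 : ℝ) ⊆ Function.support (fun x => (1 - Real.exp (-θ * x)) * Υ x) ∩ Ioi 0 :=
        fun x hx => ⟨(hpos x hx).ne', hx⟩
      exact lt_of_lt_of_le (by simp) (measure_mono hsub)
    · filter_upwards [ae_restrict_mem measurableSet_Ioi] with x hx
      exact (hpos x hx).le
    · exact hlog.integrableOn_one_sub_exp hint hθ.le
  unfold laplaceExponent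
  positivity

end LevyDensity

/-- The Cauchy–Schwarz inequality, from the sign of the discriminant of
`t ↦ ∫ (A t ^ 2 - 2 B t + C)`. -/
theorem sq_integral_le_of_sq_le {α : Type*} [MeasurableSpace α] {μ : Measure α} {A B C : α → ℝ}
    (hA : Integrable A μ) (hB : Integrable B μ) (hC : Integrable C μ)
    (hA0 : ∀ᵐ x ∂μ, 0 ≤ A x) (hC0 : ∀ᵐ x ∂μ, 0 ≤ C x) (h : ∀ᵐ x ∂μ, B x ^ 2 ≤ A x * C x) :
    (∫ x, B x ∂μ) ^ 2 ≤ (∫ x, A x ∂μ) * ∫ x, C x ∂μ := by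
  have hquad : ∀ t : ℝ, 0 ≤ (∫ x, A x ∂μ) * (t * t) + (-2 * ∫ x, B x ∂μ) * t + ∫ x, C x ∂μ := by
    intro t
    have heq : (∫ x, A x ∂μ) * (t * t) + (-2 * ∫ x, B x ∂μ) * t + ∫ x, C x ∂μ
        = ∫ x, (A x * (t * t) + B x * (-2 * t) + C x) ∂μ := by
      have hAB : Integrable (fun x => A x * (t * t) + B x * (-2 * t)) μ :=
        (hA.mul_const _).add (hB.mul_const _)
      rw [integral_add hAB hC, integral_add (hA.mul_const _) (hB.mul_const _),
        integral_mul_const, integral_mul_const]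
      ring
    rw [heq]
    refine integral_nonneg_of_ae ?_
    filter_upwards [hA0, hC0, h] with x ha hc hx
    change 0 ≤ A x * (t * t) + B x * (-2 * t) + C x
    rcases ha.eq_or_lt with ha | ha
    · have hb : B x = 0 := by
        rw [← ha, zero_mul] at hx
        exact pow_eq_zero_iff (two_ne_zero) |>.1 (le_antisymm hx (sq_nonneg _))
      rw [← ha, hb]; simpa using hc
    · have : 0 ≤ A x * (A x * (t * t) + B x * (-2 * t) + C x) := by
        nlinarith [sq_nonneg (A x * t - B x)]
      exact nonneg_of_mul_nonneg_right this ha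
  have := discrim_le_zero hquad
  rw [discrim] at this
  nlinarith

/-! ### Tails of the Lévy measure -/

/-- The tail `κ + ∫_x^∞ Υ` of the Lévy measure, including the killing rate as mass at infinity. -/
noncomputable def levyTail (κ : ℝ) (Υ : ℝ → ℝ) (x : ℝ) : ℝ :=
  κ + ∫ y in Ioi x, Υ y

section Tail

variable {κ : ℝ} {Υ : ℝ → ℝ}

theorem setIntegral_preimage_add_right (S : Set ℝ) (s : ℝ) (f : ℝ → ℝ) :
    ∫ y in (fun y => y + s) ⁻¹' S, f (y + s) = ∫ y in S, f y :=
  (measurePreserving_add_right volume s).setIntegral_preimage_emb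
    (measurableEmbedding_addRight s) f S

theorem integrableOn_preimage_add_right (S : Set ℝ) (s : ℝ) {f : ℝ → ℝ} (hf : IntegrableOn f S) :
    IntegrableOn (fun y => f (y + s)) ((fun y => y + s) ⁻¹' S) :=
  ((measurePreserving_add_right volume s).integrableOn_comp_preimage
    (measurableEmbedding_addRight s)).2 hf

/-- The integrals of a log convex function over the translates of a set are log convex. -/
theorem LogConvexOn.sq_setIntegral_le (hlog : LogConvexOn (Ioi 0) Υ)
    (hint : IntegrableOn (fun x => min 1 x * Υ x) (Ioi 0)) {a : ℝ} (ha : 0 < a) {S : Set ℝ}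
    (hS : MeasurableSet S) (hSa : S ⊆ Ioi a) {s : ℝ} (hs : 0 ≤ s) :
    (∫ y in S, Υ (y + s)) ^ 2 ≤ (∫ y in S, Υ y) * ∫ y in S, Υ (y + 2 * s) := by
  have hi : ∀ r, 0 ≤ r → IntegrableOn (fun y => Υ (y + r)) S := by
    intro r hr
    refine (integrableOn_preimage_add_right (Ioi a) r (hlog.integrableOn_Ioi hint ha)).mono_set ?_
    intro y hy
    have := hSa hy
    simp only [mem_preimage, mem_Ioi] at this ⊢
    linarith
  have hmem : ∀ y ∈ S, 0 < y := fun y hy => ha.trans (hSa hy)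
  refine sq_integral_le_of_sq_le ((hlog.integrableOn_Ioi hint ha).mono_set hSa) (hi s hs)
    (hi (2 * s) (by positivity)) ?_ ?_ ?_
  all_goals filter_upwards [ae_restrict_mem hS] with y hy
  · exact (hlog.1 y (hmem y hy)).le
  · exact (hlog.1 _ (add_pos_of_pos_of_nonneg (hmem y hy) (by positivity))).le
  · exact hlog.sq_le (hmem y hy) hs

theorem LogConvexOn.setIntegral_pos (hlog : LogConvexOn (Ioi 0) Υ)
    (hint : IntegrableOn (fun x => min 1 x * Υ x) (Ioi 0)) {a : ℝ} (ha : 0 < a) {S : Set ℝ}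
    (hS : MeasurableSet S) (hSa : S ⊆ Ioi a) (hS0 : 0 < volume S) : 0 < ∫ y in S, Υ y := by
  have hpos : ∀ y ∈ S, 0 < Υ y := fun y hy => hlog.1 y (ha.trans (hSa hy))
  rw [setIntegral_pos_iff_support_of_nonneg_ae]
  · exact hS0.trans_le (measure_mono fun y hy => ⟨(hpos y hy).ne', hy⟩)
  · filter_upwards [ae_restrict_mem hS] with y hy
    exact (hpos y hy).le
  · exact (hlog.integrableOn_Ioi hint ha).mono_set hSa

theorem LogConvexOn.levyTail_pos (hlog : LogConvexOn (Ioi 0) Υ)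
    (hint : IntegrableOn (fun x => min 1 x * Υ x) (Ioi 0)) (hκ : 0 ≤ κ) {x : ℝ} (hx : 0 < x) :
    0 < levyTail κ Υ x :=
  add_pos_of_nonneg_of_pos hκ
    (hlog.setIntegral_pos hint hx measurableSet_Ioi Subset.rfl (by simp))

theorem levyTail_sub_levyTail {f : ℝ → ℝ} {a b : ℝ} (hf : IntegrableOn f (Ioi a)) (hab : a ≤ b) :
    levyTail κ f a - levyTail κ f b = ∫ y in Ioc a b, f y := by
  have : ∫ y in Ioi a, f y = (∫ y in Ioc a b, f y) + ∫ y in Ioi b, f y := by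
    rw [← setIntegral_union (by simp [disjoint_left]) measurableSet_Ioi
      (hf.mono_set Ioc_subset_Ioi_self) (hf.mono_set (Ioi_subset_Ioi hab)),
      Ioc_union_Ioi_eq_Ioi hab]
  simp only [levyTail]
  linarith

theorem LogConvexOn.levyTail_sub (hlog : LogConvexOn (Ioi 0) Υ)
    (hint : IntegrableOn (fun x => min 1 x * Υ x) (Ioi 0)) {a b : ℝ} (ha : 0 < a) (hab : a ≤ b) :
    levyTail κ Υ a - levyTail κ Υ b = ∫ y in Ioc a b, Υ y :=
  levyTail_sub_levyTail (hlog.integrableOn_Ioi hint ha) hab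

theorem LogConvexOn.levyTail_anti (hlog : LogConvexOn (Ioi 0) Υ)
    (hint : IntegrableOn (fun x => min 1 x * Υ x) (Ioi 0)) {a b : ℝ} (ha : 0 < a) (hab : a < b) :
    levyTail κ Υ b < levyTail κ Υ a := by
  rw [← sub_pos, hlog.levyTail_sub hint ha hab.le]
  exact hlog.setIntegral_pos hint ha measurableSet_Ioc Ioc_subset_Ioi_self (by simpa using hab)

theorem LogConvexOn.levyTail_sq_le (hlog : LogConvexOn (Ioi 0) Υ)
    (hint : IntegrableOn (fun x => min 1 x * Υ x) (Ioi 0)) (hκ : 0 ≤ κ) {x s : ℝ} (hx : 0 < x)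
    (hs : 0 ≤ s) :
    levyTail κ Υ (x + s) ^ 2 ≤ levyTail κ Υ x * levyTail κ Υ (x + 2 * s) := by
  have hshift : ∀ r, ∫ y in Ioi (x + r), Υ y = ∫ y in Ioi x, Υ (y + r) := by
    intro r
    rw [← setIntegral_preimage_add_right _ r]
    simp
  have h := hlog.sq_setIntegral_le hint hx measurableSet_Ioi Subset.rfl hs
  rw [← hshift, ← hshift] at h
  have p0 := hlog.setIntegral_pos hint hx measurableSet_Ioi Subset.rfl (by simp)
  have p2 := hlog.setIntegral_pos hint (a := x + 2 * s) (by positivity)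
    measurableSet_Ioi Subset.rfl (by simp)
  have p1 := hlog.setIntegral_pos hint (a := x + s) (by positivity)
    measurableSet_Ioi Subset.rfl (by simp)
  simp only [levyTail]
  set A := ∫ y in Ioi x, Υ y
  set B := ∫ y in Ioi (x + s), Υ y
  set C := ∫ y in Ioi (x + 2 * s), Υ y
  have hAC : 2 * B ≤ A + C := by
    refine abs_le_of_sq_le_sq' ?_ (by positivity) |>.2
    nlinarith [sq_nonneg (A - C)]
  nlinarith

theorem LogConvexOn.levyTail_diff_sq_le (hlog : LogConvexOn (Ioi 0) Υ)
    (hint : IntegrableOn (fun x => min 1 x * Υ x) (Ioi 0)) {x s : ℝ} (hx : 0 < x)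
    (hs : 0 ≤ s) :
    (levyTail κ Υ (x + s) - levyTail κ Υ (x + 2 * s)) ^ 2
      ≤ (levyTail κ Υ x - levyTail κ Υ (x + s))
        * (levyTail κ Υ (x + 2 * s) - levyTail κ Υ (x + 3 * s)) := by
  have hshift : ∀ r, ∫ y in Ioc (x + r) (x + s + r), Υ y = ∫ y in Ioc x (x + s), Υ (y + r) := by
    intro r
    rw [← setIntegral_preimage_add_right _ r]
    simp
  have h := hlog.sq_setIntegral_le hint hx (measurableSet_Ioc (a := x) (b := x + s))
    Ioc_subset_Ioi_self hs
  rw [← hshift, ← hshift] at h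
  rw [hlog.levyTail_sub hint hx (by linarith), hlog.levyTail_sub hint (by linarith) (by linarith),
    hlog.levyTail_sub hint (by linarith) (by linarith), show x + 3 * s = x + s + 2 * s by ring,
    show x + 2 * s = x + s + s by ring]
  rw [show x + 2 * s = x + s + s by ring] at h
  exact h

/-- The tail sequence of the compound Poisson process on `h ℕ` that approximates the subordinator.
The Lévy mass of `(j h, (j + 1) h]` is moved to `j h` for `j ≥ 1`, that of `(0, h]` is dropped, and
the drift `d` becomes a jump rate `d / h` at `h`. The term of index `k` is the rate of jumps of
size greater than `k h`, killing included. -/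
noncomputable def discreteTail (κ d : ℝ) (Υ : ℝ → ℝ) (h : ℝ) (k : ℕ) : ℝ :=
  levyTail κ Υ ((k + 1) * h) + if k = 0 then d / h else 0

variable {d h : ℝ}

theorem levyTail_le_discreteTail (hd : 0 ≤ d) (hh : 0 < h) (k : ℕ) :
    levyTail κ Υ ((k + 1) * h) ≤ discreteTail κ d Υ h k := by
  unfold discreteTail
  split_ifs
  · have : 0 ≤ d / h := by positivity
    linarith
  · simp

theorem discreteTail_succ (k : ℕ) :
    discreteTail κ d Υ h (k + 1) = levyTail κ Υ ((k + 1) * h + h) := by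
  simp only [discreteTail, Nat.succ_ne_zero, if_false, add_zero]
  push_cast
  ring_nf

theorem LogConvexOn.discreteTail_pos (hlog : LogConvexOn (Ioi 0) Υ)
    (hint : IntegrableOn (fun x => min 1 x * Υ x) (Ioi 0)) (hκ : 0 ≤ κ) (hd : 0 ≤ d) (hh : 0 < h)
    (k : ℕ) : 0 < discreteTail κ d Υ h k :=
  (hlog.levyTail_pos hint hκ (by positivity)).trans_le (levyTail_le_discreteTail hd hh k)

theorem LogConvexOn.discreteTail_anti (hlog : LogConvexOn (Ioi 0) Υ)
    (hint : IntegrableOn (fun x => min 1 x * Υ x) (Ioi 0)) (hd : 0 ≤ d) (hh : 0 < h)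
    (k : ℕ) : discreteTail κ d Υ h (k + 1) < discreteTail κ d Υ h k := by
  refine lt_of_lt_of_le ?_ (levyTail_le_discreteTail hd hh k)
  rw [discreteTail_succ]
  exact hlog.levyTail_anti hint (by positivity) (by linarith)

theorem LogConvexOn.discreteTail_sq_le (hlog : LogConvexOn (Ioi 0) Υ)
    (hint : IntegrableOn (fun x => min 1 x * Υ x) (Ioi 0)) (hκ : 0 ≤ κ) (hd : 0 ≤ d) (hh : 0 < h)
    (k : ℕ) : discreteTail κ d Υ h (k + 1) ^ 2
      ≤ discreteTail κ d Υ h k * discreteTail κ d Υ h (k + 2) := by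
  have e2 : discreteTail κ d Υ h (k + 2) = levyTail κ Υ ((k + 1) * h + 2 * h) := by
    rw [discreteTail_succ]; push_cast; ring_nf
  have hx : 0 < ((k : ℝ) + 1) * h := by positivity
  refine le_trans ?_ (mul_le_mul_of_nonneg_right (levyTail_le_discreteTail hd hh k)
    (hlog.discreteTail_pos hint hκ hd hh (k + 2)).le)
  rw [e2, discreteTail_succ]
  exact hlog.levyTail_sq_le hint hκ hx hh.le

theorem LogConvexOn.discreteTail_diff_sq_le (hlog : LogConvexOn (Ioi 0) Υ)
    (hint : IntegrableOn (fun x => min 1 x * Υ x) (Ioi 0)) (hd : 0 ≤ d) (hh : 0 < h)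
    (k : ℕ) : (discreteTail κ d Υ h (k + 1) - discreteTail κ d Υ h (k + 2)) ^ 2
      ≤ (discreteTail κ d Υ h k - discreteTail κ d Υ h (k + 1))
        * (discreteTail κ d Υ h (k + 2) - discreteTail κ d Υ h (k + 3)) := by
  have e2 : discreteTail κ d Υ h (k + 2) = levyTail κ Υ ((k + 1) * h + 2 * h) := by
    rw [discreteTail_succ]; push_cast; ring_nf
  have e3 : discreteTail κ d Υ h (k + 3) = levyTail κ Υ ((k + 1) * h + 3 * h) := by
    rw [discreteTail_succ]; push_cast; ring_nf
  have hx : 0 < ((k : ℝ) + 1) * h := by positivity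
  refine le_trans ?_ (mul_le_mul_of_nonneg_right
    (sub_le_sub_right (levyTail_le_discreteTail hd hh k) _)
    (sub_nonneg.2 (hlog.discreteTail_anti hint hd hh (k + 2)).le))
  rw [e2, e3, discreteTail_succ]
  exact hlog.levyTail_diff_sq_le hint hx hh.le

end Tail

/-! ### Approximation by renewal processes on a grid -/

/-- The Laplace exponent of the compound Poisson process on `h ℕ` with tail sequence
`discreteTail`. -/
noncomputable def discreteExponent (κ d : ℝ) (Υ : ℝ → ℝ) (h θ : ℝ) : ℝ :=
  κ + d * ((1 - Real.exp (-θ * h)) / h)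
    + ∫ x in Ioi (0 : ℝ), (1 - Real.exp (-θ * h) ^ (⌈x / h⌉₊ - 1)) * Υ x

section Grid

variable {κ d h : ℝ} {Υ : ℝ → ℝ}

/-- For `x > 0`, the number of grid points `(k + 1) h` strictly below `x` is `⌈x / h⌉₊ - 1`. -/
theorem hasSum_pow_mul_indicator {z x : ℝ} (hz : z ≠ 1) (hh : 0 < h) :
    HasSum (fun k : ℕ => z ^ k * (Ioi (((k : ℝ) + 1) * h)).indicator Υ x)
      ((Ioi (0 : ℝ)).indicator (fun x => (1 - z ^ (⌈x / h⌉₊ - 1)) * Υ x / (1 - z)) x) := by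
  by_cases hx : x ∈ Ioi (0 : ℝ)
  · rw [indicator_of_mem hx]
    have hiff : ∀ k : ℕ, x ∈ Ioi (((k : ℝ) + 1) * h) ↔ k < ⌈x / h⌉₊ - 1 := by
      intro k
      rw [mem_Ioi, ← lt_div_iff₀ hh, Nat.lt_sub_iff_add_lt, Nat.lt_ceil]
      push_cast
      rfl
    have hval : (1 - z ^ (⌈x / h⌉₊ - 1)) * Υ x / (1 - z)
        = ∑ k ∈ Finset.range (⌈x / h⌉₊ - 1),
          z ^ k * (Ioi (((k : ℝ) + 1) * h)).indicator Υ x := by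
      rw [Finset.sum_congr rfl fun k hk => by
        rw [indicator_of_mem ((hiff k).2 (Finset.mem_range.1 hk))], ← Finset.sum_mul,
        geom_sum_eq hz]
      have h1 : 1 - z ≠ 0 := sub_ne_zero.2 hz.symm
      have h2 : z - 1 ≠ 0 := sub_ne_zero.2 hz
      field_simp
      ring
    rw [hval]
    refine hasSum_sum_of_ne_finset_zero fun k hk => ?_
    rw [indicator_of_notMem (fun hm => hk (Finset.mem_range.2 ((hiff k).1 hm))), mul_zero]
  · rw [indicator_of_notMem hx]
    convert hasSum_zero with k
    have hk : x ∉ Ioi (((k : ℝ) + 1) * h) := fun hm =>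
      hx ((show (0 : ℝ) < (k + 1) * h by positivity).trans hm)
    rw [indicator_of_notMem hk, mul_zero]

theorem LogConvexOn.hasSum_setIntegral_Ioi (hlog : LogConvexOn (Ioi 0) Υ)
    (hint : IntegrableOn (fun x => min 1 x * Υ x) (Ioi 0)) {z : ℝ} (hz0 : 0 < z) (hz1 : z < 1)
    (hh : 0 < h) :
    HasSum (fun k : ℕ => (∫ y in Ioi (((k : ℝ) + 1) * h), Υ y) * z ^ k)
      ((∫ x in Ioi (0 : ℝ), (1 - z ^ (⌈x / h⌉₊ - 1)) * Υ x) / (1 - z)) := by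
  have hpos : ∀ k : ℕ, 0 < ((k : ℝ) + 1) * h := fun k => by positivity
  have hF : ∀ k : ℕ, Integrable
      (fun x => z ^ k * (Ioi (((k : ℝ) + 1) * h)).indicator Υ x) := fun k =>
    ((integrable_indicator_iff measurableSet_Ioi).2
      (hlog.integrableOn_Ioi hint (hpos k))).const_mul _
  have hval : ∀ k : ℕ, ∫ x, z ^ k * (Ioi (((k : ℝ) + 1) * h)).indicator Υ x
      = (∫ y in Ioi (((k : ℝ) + 1) * h), Υ y) * z ^ k := by
    intro k
    rw [integral_const_mul, integral_indicator measurableSet_Ioi, mul_comm]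
  have hnorm : ∀ k : ℕ, ∫ x, ‖z ^ k * (Ioi (((k : ℝ) + 1) * h)).indicator Υ x‖
      = (∫ y in Ioi (((k : ℝ) + 1) * h), Υ y) * z ^ k := by
    intro k
    rw [← hval k]
    refine integral_congr_ae (ae_of_all _ fun x => Real.norm_of_nonneg ?_)
    refine mul_nonneg (by positivity) (indicator_nonneg (fun y hy => ?_) _)
    exact (hlog.1 y ((hpos k).trans hy)).le
  have hsum : Summable fun k : ℕ =>
      ∫ x, ‖z ^ k * (Ioi (((k : ℝ) + 1) * h)).indicator Υ x‖ := by
    simp_rw [hnorm]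
    refine Summable.of_nonneg_of_le (fun k => ?_) (fun k => ?_)
      ((summable_geometric_of_lt_one hz0.le hz1).mul_left (∫ y in Ioi h, Υ y))
    · refine mul_nonneg (setIntegral_nonneg measurableSet_Ioi fun y hy => ?_) (by positivity)
      exact (hlog.1 y ((hpos k).trans hy)).le
    · refine mul_le_mul_of_nonneg_right ?_ (by positivity)
      refine setIntegral_mono_set (hlog.integrableOn_Ioi hint hh) ?_ ?_
      · filter_upwards [ae_restrict_mem measurableSet_Ioi] with y hy
        exact (hlog.1 y (hh.trans hy)).le
      · refine Eventually.of_forall (Ioi_subset_Ioi ?_)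
        nlinarith [(Nat.cast_nonneg k : (0 : ℝ) ≤ k)]
  have hswap := hasSum_integral_of_summable_integral_norm hF hsum
  simp_rw [hval] at hswap
  have heq : ∫ x, ∑' k : ℕ, z ^ k * (Ioi (((k : ℝ) + 1) * h)).indicator Υ x
      = (∫ x in Ioi (0 : ℝ), (1 - z ^ (⌈x / h⌉₊ - 1)) * Υ x) / (1 - z) := by
    simp_rw [fun x => (hasSum_pow_mul_indicator (Υ := Υ) (x := x) hz1.ne hh).tsum_eq]
    rw [integral_indicator measurableSet_Ioi, integral_div]
  rwa [heq] at hswap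

/-- The generating function of `discreteTail` at `exp (-θ h)`. -/
theorem LogConvexOn.hasSum_discreteTail (hlog : LogConvexOn (Ioi 0) Υ)
    (hint : IntegrableOn (fun x => min 1 x * Υ x) (Ioi 0)) {θ : ℝ} (hθ : 0 < θ)
    (hh : 0 < h) :
    HasSum (fun k : ℕ => discreteTail κ d Υ h k * Real.exp (-θ * h) ^ k)
      (discreteExponent κ d Υ h θ / (1 - Real.exp (-θ * h))) := by
  have hz1 : Real.exp (-θ * h) < 1 := Real.exp_lt_one_iff.2 (by nlinarith)
  unfold discreteExponent
  set z := Real.exp (-θ * h)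
  have hz0 : 0 < z := Real.exp_pos _
  have hz1' : 1 - z ≠ 0 := (sub_pos.2 hz1).ne'
  have e1 : HasSum (fun k : ℕ => κ * z ^ k) (κ * (1 - z)⁻¹) :=
    (hasSum_geometric_of_lt_one hz0.le hz1).mul_left κ
  have e2 : HasSum (fun k : ℕ => (if k = 0 then d / h else 0) * z ^ k) (d / h) := by
    convert hasSum_single (f := fun k : ℕ => (if k = 0 then d / h else 0) * z ^ k) 0 ?_ using 1
    · simp
    · intro k hk
      simp [hk]
  have e3 := hlog.hasSum_setIntegral_Ioi hint hz0 hz1 hh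
  convert (e1.add e3).add e2 using 1
  · funext k
    simp only [discreteTail, levyTail]
    ring
  · field_simp
    ring

/-- The grid point below `x` is at most `x`, so `(1 - exp (-θ x)) Υ(x)` dominates the integrands. -/
theorem LogConvexOn.tendsto_discreteExponent (hlog : LogConvexOn (Ioi 0) Υ)
    (hint : IntegrableOn (fun x => min 1 x * Υ x) (Ioi 0)) {θ : ℝ} (hθ : 0 < θ) :
    Tendsto (fun h => discreteExponent κ d Υ h θ) (𝓝[>] 0) (𝓝 (laplaceExponent κ d Υ θ)) := by
  have hdrift : Tendsto (fun h => (1 - Real.exp (-θ * h)) / h) (𝓝[>] 0) (𝓝 θ) := by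
    have hder : HasDerivAt (fun h : ℝ => 1 - Real.exp (-θ * h)) θ 0 := by
      have h1 : HasDerivAt (fun h : ℝ => -θ * h) (-θ) 0 := by
        simpa using (hasDerivAt_id (0 : ℝ)).const_mul (-θ)
      simpa using h1.exp.const_sub 1
    refine hder.tendsto_slope_zero_right.congr fun h => ?_
    simp [div_eq_inv_mul]
  have hN : ∀ x h : ℝ, 0 < x → 0 < h →
      x - h ≤ ((⌈x / h⌉₊ - 1 : ℕ) : ℝ) * h ∧ ((⌈x / h⌉₊ - 1 : ℕ) : ℝ) * h ≤ x := by
    intro x h hx hh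
    have hc : 1 ≤ ⌈x / h⌉₊ := Nat.one_le_ceil_iff.2 (by positivity)
    rw [Nat.cast_sub hc, Nat.cast_one]
    have h1 : x ≤ ⌈x / h⌉₊ * h := (div_le_iff₀ hh).1 (Nat.le_ceil _)
    have h2 : (⌈x / h⌉₊ - 1 : ℝ) * h < x := by
      rw [← lt_div_iff₀ hh]
      linarith [Nat.ceil_lt_add_one (by positivity : 0 ≤ x / h)]
    exact ⟨by linarith, h2.le⟩
  have hpow : ∀ (h : ℝ) (n : ℕ), Real.exp (-θ * h) ^ n = Real.exp (-θ * (n * h)) := by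
    intro h n
    rw [← Real.exp_nat_mul]
    ring_nf
  refine (tendsto_const_nhds.add (hdrift.const_mul d)).add ?_
  refine tendsto_integral_filter_of_dominated_convergence
    (fun x => (1 - Real.exp (-θ * x)) * Υ x) ?_ ?_ (hlog.integrableOn_one_sub_exp hint hθ.le) ?_
  · refine Eventually.of_forall fun h => AEStronglyMeasurable.mul ?_ hlog.aestronglyMeasurable
    simp_rw [hpow]
    have : Measurable fun x : ℝ => ((⌈x / h⌉₊ - 1 : ℕ) : ℝ) :=
      (measurable_from_nat (f := fun n : ℕ => ((n - 1 : ℕ) : ℝ))).comp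
        (Nat.measurable_ceil.comp (measurable_id.div_const h))
    exact Measurable.aestronglyMeasurable (by fun_prop)
  · filter_upwards [self_mem_nhdsWithin] with h hh
    filter_upwards [ae_restrict_mem measurableSet_Ioi] with x hx
    have hx0 : (0 : ℝ) < x := hx
    have hh0 : (0 : ℝ) < h := hh
    have hΥ := hlog.1 x hx
    rw [hpow, norm_mul, Real.norm_of_nonneg (one_sub_exp_nonneg hθ.le (by positivity)),
      Real.norm_of_nonneg hΥ.le]
    refine mul_le_mul_of_nonneg_right (sub_le_sub_left (Real.exp_le_exp.2 ?_) 1) hΥ.le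
    have := (hN x h hx0 hh0).2
    nlinarith
  · filter_upwards [ae_restrict_mem measurableSet_Ioi] with x hx
    have hx0 : (0 : ℝ) < x := hx
    have hlim : Tendsto (fun h => ((⌈x / h⌉₊ - 1 : ℕ) : ℝ) * h) (𝓝[>] 0) (𝓝 x) := by
      have h1 : Tendsto (fun h : ℝ => x - h) (𝓝[>] 0) (𝓝 x) := by
        have : Tendsto (fun h : ℝ => x - h) (𝓝 0) (𝓝 (x - 0)) := tendsto_const_nhds.sub tendsto_id
        rw [sub_zero] at this
        exact this.mono_left nhdsWithin_le_nhds
      refine tendsto_of_tendsto_of_tendsto_of_le_of_le' h1 tendsto_const_nhds ?_ ?_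
      · filter_upwards [self_mem_nhdsWithin] with h hh using (hN x h hx0 hh).1
      · filter_upwards [self_mem_nhdsWithin] with h hh using (hN x h hx0 hh).2
    simp_rw [hpow]
    exact (((Real.continuous_exp.tendsto _).comp (hlim.const_mul (-θ))).const_sub 1).mul_const _

end Grid

/-- The solution of the renewal equation is the coefficient sequence of the power series
`B⁻¹ / (1 - X)`, where `B = ∑ b k X ^ k`. -/
theorem exists_renewal {b : ℕ → ℝ} (hb : b 0 ≠ 0) :
    ∃ u : ℕ → ℝ, ∀ n, ∑ k ∈ Finset.range (n + 1), b k * u (n - k) = 1 := by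
  set B : PowerSeries ℝ := PowerSeries.mk b with hB
  have hB0 : PowerSeries.constantCoeff B ≠ 0 := by
    rw [hB, ← PowerSeries.coeff_zero_eq_constantCoeff_apply, PowerSeries.coeff_mk]
    exact hb
  set W : PowerSeries ℝ := B⁻¹ * PowerSeries.mk fun _ => 1 with hW
  have hBW : B * W = PowerSeries.mk fun _ => 1 := by
    rw [hW, ← mul_assoc, PowerSeries.mul_inv_cancel B hB0, one_mul]
  refine ⟨fun n => PowerSeries.coeff n W, fun n => ?_⟩
  have := congrArg (PowerSeries.coeff n) hBW
  rw [PowerSeries.coeff_mul, PowerSeries.coeff_mk,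
    Finset.Nat.sum_antidiagonal_eq_sum_range_succ_mk] at this
  simpa [hB, PowerSeries.coeff_mk] using this

/-- The measure with mass `u k` at the grid point `k h`. -/
noncomputable def gridMeasure (u : ℕ → ℝ) (h : ℝ) : Measure ℝ :=
  Measure.sum fun k : ℕ => ENNReal.ofReal (u k) • Measure.dirac ((k : ℝ) * h)

section GridMeasure

variable {u : ℕ → ℝ} {h : ℝ}

theorem lintegral_gridMeasure (f : ℝ → ℝ≥0∞) :
    ∫⁻ x, f x ∂gridMeasure u h = ∑' k : ℕ, ENNReal.ofReal (u k) * f (k * h) := by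
  rw [gridMeasure, lintegral_sum_measure]
  refine tsum_congr fun k => ?_
  rw [lintegral_smul_measure, lintegral_dirac, smul_eq_mul]

theorem gridMeasure_Iio_zero (hh : 0 < h) : gridMeasure u h (Iio 0) = 0 := by
  rw [← lintegral_indicator_one measurableSet_Iio, lintegral_gridMeasure]
  refine ENNReal.tsum_eq_zero.2 fun k => ?_
  rw [indicator_of_notMem, mul_zero]
  simp only [mem_Iio, not_lt]
  positivity

/-- By the Cauchy product, a renewal measure has as Laplace transform the reciprocal of the
exponent. -/
theorem laplaceTransform_gridMeasure {b : ℕ → ℝ} (hu0 : ∀ n, 0 ≤ u n)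
    (hanti : ∀ n, u (n + 1) ≤ u n)
    (hu : ∀ n, ∑ k ∈ Finset.range (n + 1), b k * u (n - k) = 1)
    {θ S : ℝ} (hθ : 0 < θ) (hh : 0 < h)
    (hS : HasSum (fun k : ℕ => b k * Real.exp (-θ * h) ^ k) (S / (1 - Real.exp (-θ * h)))) :
    laplaceTransform (gridMeasure u h) θ = ENNReal.ofReal (1 / S) := by
  have hz1 : Real.exp (-θ * h) < 1 := Real.exp_lt_one_iff.2 (by nlinarith)
  have hpow : ∀ n : ℕ, Real.exp (-θ * (n * h)) = Real.exp (-θ * h) ^ n := by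
    intro n
    rw [← Real.exp_nat_mul]
    ring_nf
  rw [laplaceTransform, lintegral_gridMeasure]
  simp_rw [hpow]
  set z := Real.exp (-θ * h)
  have hz0 : 0 < z := Real.exp_pos _
  have hgeo := hasSum_geometric_of_lt_one hz0.le hz1
  have hule : ∀ n, u n ≤ u 0 := fun n => antitone_nat_of_succ_le hanti (Nat.zero_le n)
  have husum : Summable fun k => u k * z ^ k :=
    Summable.of_nonneg_of_le (fun k => mul_nonneg (hu0 k) (by positivity))
      (fun k => mul_le_mul_of_nonneg_right (hule k) (by positivity)) (hgeo.summable.mul_left (u 0))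
  have hprod := tsum_mul_tsum_eq_tsum_sum_range_of_summable_norm hS.summable.norm husum.norm
  have hcoef : ∀ n : ℕ, ∑ k ∈ Finset.range (n + 1), b k * z ^ k * (u (n - k) * z ^ (n - k))
      = z ^ n := by
    intro n
    rw [← one_mul (z ^ n), ← hu n, Finset.sum_mul]
    refine Finset.sum_congr rfl fun k hk => ?_
    rw [← pow_mul_pow_sub z (Finset.mem_range_succ_iff.1 hk)]
    ring
  simp_rw [hcoef] at hprod
  rw [hS.tsum_eq, hgeo.tsum_eq] at hprod
  have h1z : 1 - z ≠ 0 := (sub_pos.2 hz1).ne'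
  have hval : ∑' k, u k * z ^ k = 1 / S := by
    have hSU : S * ∑' k, u k * z ^ k = 1 := by
      have := congrArg (fun t => t * (1 - z)) hprod
      rw [inv_mul_cancel₀ h1z] at this
      rw [← this]
      field_simp
    exact eq_one_div_of_mul_eq_one_right hSU
  rw [← hval, ENNReal.ofReal_tsum_of_nonneg (fun k => mul_nonneg (hu0 k) (by positivity)) husum]
  exact tsum_congr fun k => (ENNReal.ofReal_mul (hu0 k)).symm

theorem lintegral_gridMeasure_comp_sub {f : ℝ → ℝ≥0∞} (hf : ∀ x ≤ 0, f x = 0) (hh : 0 < h)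
    (m : ℕ) : ∫⁻ x, f (x - m * h) ∂gridMeasure u h
      = ∑' k : ℕ, ENNReal.ofReal (u (k + m)) * f (k * h) := by
  rw [lintegral_gridMeasure, ← (ENNReal.summable).sum_add_tsum_nat_add' (k := m),
    Finset.sum_eq_zero, zero_add]
  · refine tsum_congr fun k => ?_
    push_cast
    ring_nf
  · intro k hk
    have : (k : ℝ) ≤ m := by exact_mod_cast (Finset.mem_range.1 hk).le
    rw [hf _ (by nlinarith), mul_zero]

theorem lintegral_gridMeasure_comp_sub_le (hanti : ∀ n, u (n + 1) ≤ u n) {f : ℝ → ℝ≥0∞}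
    (hf : ∀ x ≤ 0, f x = 0) (hh : 0 < h) (m : ℕ) :
    ∫⁻ x, f (x - m * h) ∂gridMeasure u h ≤ ∫⁻ x, f x ∂gridMeasure u h := by
  rw [lintegral_gridMeasure_comp_sub hf hh, lintegral_gridMeasure]
  refine ENNReal.tsum_le_tsum fun k => mul_le_mul_left (ENNReal.ofReal_le_ofReal ?_) _
  exact antitone_nat_of_succ_le hanti (by omega)

theorem two_mul_le_of_convex (hconv : ∀ n, 2 * u (n + 1) ≤ u n + u (n + 2)) (m k : ℕ) :
    2 * u (k + m) ≤ u k + u (k + 2 * m) := by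
  have hw : Antitone fun n => u n - u (n + 1) :=
    antitone_nat_of_succ_le fun n => by linarith [hconv n]
  have hD : Antitone fun n => u n - u (n + m) := antitone_nat_of_succ_le fun n => by
    have := hw (show n ≤ n + m by omega)
    simp only at this
    rw [show n + 1 + m = n + m + 1 by ring]
    linarith
  have := hD (show k ≤ k + m by omega)
  simp only at this
  rw [show k + m + m = k + 2 * m by ring] at this
  linarith

theorem two_mul_lintegral_gridMeasure_comp_sub_le (hu0 : ∀ n, 0 ≤ u n)
    (hconv : ∀ n, 2 * u (n + 1) ≤ u n + u (n + 2)) {f : ℝ → ℝ≥0∞}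
    (hf : ∀ x ≤ 0, f x = 0) (hh : 0 < h) (m : ℕ) :
    2 * ∫⁻ x, f (x - m * h) ∂gridMeasure u h
      ≤ ∫⁻ x, f x ∂gridMeasure u h + ∫⁻ x, f (x - (2 * m : ℕ) * h) ∂gridMeasure u h := by
  rw [lintegral_gridMeasure_comp_sub hf hh, lintegral_gridMeasure_comp_sub hf hh,
    lintegral_gridMeasure, ← ENNReal.tsum_mul_left, ← ENNReal.tsum_add]
  refine ENNReal.tsum_le_tsum fun k => ?_
  rw [← mul_assoc, ← add_mul, ← ENNReal.ofReal_add (hu0 _) (hu0 _)]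
  refine mul_le_mul_left ?_ _
  rw [show (2 : ℝ≥0∞) = ENNReal.ofReal 2 by simp, ← ENNReal.ofReal_mul zero_le_two]
  exact ENNReal.ofReal_le_ofReal (two_mul_le_of_convex hconv m k)

end GridMeasure

/-! ### The convex potential density -/

/-- A measure with Laplace transform `1 / φ` is a vague limit of renewal measures on the grids of
mesh `s / (m + 1)`. These are convex and non-increasing sequences of masses, and `s` is a
multiple of the mesh, so the inequalities between translates by `s` pass to the limit. -/
theorem LogConvexOn.exists_gridMeasure_approx {κ d : ℝ} {Υ : ℝ → ℝ} {U : Measure ℝ}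
    (hlog : LogConvexOn (Ioi 0) Υ) (hint : IntegrableOn (fun x => min 1 x * Υ x) (Ioi 0))
    (hκ : 0 ≤ κ) (hd : 0 ≤ d) (hU0 : U (Iio 0) = 0)
    (hU : ∀ θ, 0 < θ → laplaceTransform U θ = ENNReal.ofReal (1 / laplaceExponent κ d Υ θ))
    {s : ℝ} (hs : 0 < s) :
    ∃ u : ℕ → ℕ → ℝ, (∀ m n, 0 ≤ u m n) ∧ (∀ m n, u m (n + 1) ≤ u m n) ∧
      (∀ m n, 2 * u m (n + 1) ≤ u m n + u m (n + 2)) ∧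
      (∀ m, laplaceTransform (gridMeasure (u m) (s / (m + 1))) 1 ≠ ∞) ∧
      ∀ F : ℝ → ℝ, Continuous F → HasCompactSupport F →
        Tendsto (fun m => ∫ x, F x ∂gridMeasure (u m) (s / (m + 1))) atTop (𝓝 (∫ x, F x ∂U)) := by
  have hh : ∀ m : ℕ, 0 < s / ((m : ℝ) + 1) := fun m => by positivity
  have hb : ∀ m n : ℕ, 0 < discreteTail κ d Υ (s / ((m : ℝ) + 1)) n := fun m n =>
    hlog.discreteTail_pos hint hκ hd (hh m) n
  choose u hu using fun m : ℕ => exists_renewal (hb m 0).ne'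
  have hu0 : ∀ m n, 0 ≤ u m n := fun m =>
    renewal_nonneg (hb m) (fun n => (hlog.discreteTail_anti hint hd (hh m) n).le) (hu m)
  have huanti : ∀ m n, u m (n + 1) ≤ u m n := fun m =>
    renewal_antitone (hb m) (hlog.discreteTail_sq_le hint hκ hd (hh m)) (hu m)
  have huconv : ∀ m n, 2 * u m (n + 1) ≤ u m n + u m (n + 2) := fun m =>
    renewal_convex (hb m) (hlog.discreteTail_anti hint hd (hh m))
      (hlog.discreteTail_sq_le hint hκ hd (hh m)) (hlog.discreteTail_diff_sq_le hint hd (hh m))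
      (hu m)
  have hlap : ∀ (m : ℕ) (θ : ℝ), 0 < θ → laplaceTransform (gridMeasure (u m) (s / (m + 1))) θ
      = ENNReal.ofReal (1 / discreteExponent κ d Υ (s / (m + 1)) θ) := fun m θ hθ =>
    laplaceTransform_gridMeasure (hu0 m) (huanti m) (hu m) hθ (hh m)
      (hlog.hasSum_discreteTail hint hθ (hh m))
  have hlap1 : ∀ m : ℕ, laplaceTransform (gridMeasure (u m) (s / (m + 1))) 1 ≠ ∞ := fun m => by
    rw [hlap m 1 one_pos]; exact ENNReal.ofReal_ne_top
  refine ⟨u, hu0, huanti, huconv, hlap1, fun F hF hc => ?_⟩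
  have hmesh : Tendsto (fun m : ℕ => s / ((m : ℝ) + 1)) atTop (𝓝[>] 0) := by
    refine tendsto_nhdsWithin_iff.2 ⟨?_, Eventually.of_forall hh⟩
    exact tendsto_const_nhds.div_atTop
      (tendsto_atTop_add_const_right _ _ tendsto_natCast_atTop_atTop)
  refine tendsto_integral_of_tendsto_laplaceTransform (fun m => gridMeasure_Iio_zero (hh m)) hU0
    hlap1 (by rw [hU 1 one_pos]; exact ENNReal.ofReal_ne_top) (fun k => ?_) hF hc
  have hk : (0 : ℝ) < k + 1 := by positivity
  rw [hU _ hk]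
  simp_rw [fun m => hlap m _ hk]
  refine ENNReal.tendsto_ofReal (Tendsto.div tendsto_const_nhds
    ((hlog.tendsto_discreteExponent hint hk).comp hmesh)
    (hlog.laplaceExponent_pos hint hκ hd hk).ne')

/-- If the Lévy density is log convex, a measure with Laplace transform `1 / φ` has a
non-increasing convex density on `(0, ∞)`. -/
theorem LogConvexOn.exists_convex_density {κ d : ℝ} {Υ : ℝ → ℝ} {U : Measure ℝ}
    (hlog : LogConvexOn (Ioi 0) Υ) (hint : IntegrableOn (fun x => min 1 x * Υ x) (Ioi 0))
    (hκ : 0 ≤ κ) (hd : 0 ≤ d) (hU0 : U (Iio 0) = 0)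
    (hU : ∀ θ, 0 < θ → laplaceTransform U θ = ENNReal.ofReal (1 / laplaceExponent κ d Υ θ)) :
    ∃ u : ℝ → ℝ, (∀ x ∈ Ioi (0 : ℝ), 0 ≤ u x) ∧
      U.restrict (Ioi 0) = (volume.restrict (Ioi 0)).withDensity (fun x => ENNReal.ofReal (u x)) ∧
      AntitoneOn u (Ioi 0) ∧ ConvexOn ℝ (Ioi 0) u := by
  have hU1 : laplaceTransform U 1 ≠ ∞ := by rw [hU 1 one_pos]; exact ENNReal.ofReal_ne_top
  have hshift : ∀ (a b r x : ℝ) (n : ℕ),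
      trapezium (a + r) (b + r) n x = trapezium a b n (x - r) := by
    intro a b r x n
    unfold trapezium
    rw [show x - (a + r) = x - r - a by ring, show b + r - x = b - (x - r) by ring]
  have hzero : ∀ (a b : ℝ) (n : ℕ), 0 < a → ∀ x ≤ 0, ENNReal.ofReal (trapezium a b n x) = 0 := by
    intro a b n ha x hx
    rw [trapezium_eq_zero_of_le n (hx.trans ha.le), ENNReal.ofReal_zero]
  have hlim : ∀ a b : ℝ, Tendsto (fun n => ∫ x, trapezium a b n x ∂U) atTop
      (𝓝 (U.real (Ioc a b))) := fun a b =>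
    tendsto_integral_trapezium (measure_Ioc_ne_top hU1 a (b + 1))
  refine exists_convex_density_of_translates (fun b => measure_Ioc_ne_top hU1 0 b) ?_ ?_
  · intro a b s ha _ hs
    refine le_of_tendsto_of_tendsto' (hlim (a + s) (b + s)) (hlim a b) fun n => ?_
    obtain ⟨u, hu0, huanti, huconv, hu1, hconv⟩ :=
      hlog.exists_gridMeasure_approx hint hκ hd hU0 hU hs
    refine le_of_tendsto_of_tendsto'
      (hconv _ (continuous_trapezium n) (hasCompactSupport_trapezium n))
      (hconv _ (continuous_trapezium n) (hasCompactSupport_trapezium n)) fun m => ?_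
    have hh : 0 < s / ((m : ℝ) + 1) := by positivity
    have hi : ∀ a b : ℝ, Integrable (trapezium a b n) (gridMeasure (u m) (s / (m + 1))) :=
      fun a b => integrable_of_laplaceTransform_ne_top (gridMeasure_Iio_zero hh) (hu1 m)
        (continuous_trapezium n) (hasCompactSupport_trapezium n)
    have hnn : ∀ a b : ℝ, 0 ≤ ∫ x, trapezium a b n x ∂gridMeasure (u m) (s / (m + 1)) :=
      fun a b => integral_nonneg fun x => trapezium_nonneg n x
    rw [← ENNReal.ofReal_le_ofReal_iff (hnn _ _),
      ofReal_integral_eq_lintegral_ofReal (hi _ _) (ae_of_all _ fun x => trapezium_nonneg n x),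
      ofReal_integral_eq_lintegral_ofReal (hi _ _) (ae_of_all _ fun x => trapezium_nonneg n x)]
    have := lintegral_gridMeasure_comp_sub_le (huanti m) (hzero a b n ha) hh (m + 1)
    rw [show ((m + 1 : ℕ) : ℝ) * (s / (m + 1)) = s by push_cast; field_simp] at this
    simp_rw [hshift]
    exact this
  · intro a b s ha _ hs
    refine le_of_tendsto_of_tendsto' ((hlim (a + s) (b + s)).const_mul 2)
      ((hlim a b).add (hlim (a + 2 * s) (b + 2 * s))) fun n => ?_
    obtain ⟨u, hu0, huanti, huconv, hu1, hconv⟩ :=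
      hlog.exists_gridMeasure_approx hint hκ hd hU0 hU hs
    have hconv' := fun a b => hconv _ (continuous_trapezium (a := a) (b := b) n)
      (hasCompactSupport_trapezium n)
    refine le_of_tendsto_of_tendsto' ((hconv' _ _).const_mul 2)
      ((hconv' _ _).add (hconv' _ _)) fun m => ?_
    have hh : 0 < s / ((m : ℝ) + 1) := by positivity
    have hi : ∀ a b : ℝ, Integrable (trapezium a b n) (gridMeasure (u m) (s / (m + 1))) :=
      fun a b => integrable_of_laplaceTransform_ne_top (gridMeasure_Iio_zero hh) (hu1 m)
        (continuous_trapezium n) (hasCompactSupport_trapezium n)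
    have hnn : ∀ a b : ℝ, 0 ≤ ∫ x, trapezium a b n x ∂gridMeasure (u m) (s / (m + 1)) :=
      fun a b => integral_nonneg fun x => trapezium_nonneg n x
    rw [← ENNReal.ofReal_le_ofReal_iff (add_nonneg (hnn _ _) (hnn _ _)),
      ENNReal.ofReal_mul zero_le_two, ENNReal.ofReal_add (hnn _ _) (hnn _ _),
      ofReal_integral_eq_lintegral_ofReal (hi _ _) (ae_of_all _ fun x => trapezium_nonneg n x),
      ofReal_integral_eq_lintegral_ofReal (hi _ _) (ae_of_all _ fun x => trapezium_nonneg n x),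
      ofReal_integral_eq_lintegral_ofReal (hi _ _) (ae_of_all _ fun x => trapezium_nonneg n x)]
    have := two_mul_lintegral_gridMeasure_comp_sub_le (hu0 m) (huconv m) (hzero a b n ha) hh
      (m + 1)
    rw [show ((m + 1 : ℕ) : ℝ) * (s / (m + 1)) = s by push_cast; field_simp,
      show ((2 * (m + 1) : ℕ) : ℝ) * (s / (m + 1)) = 2 * s by push_cast; field_simp] at this
    simp_rw [hshift]
    simpa using this

/-! ### The Laplace transform of the potential measure -/

section Potential

variable {Ω : Type*} [MeasurableSpace Ω] {P : Measure Ω} {H : ℝ≥0 → Ω → ℝ≥0∞}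

theorem potentialMeasure_Iio_zero [IsProbabilityMeasure P] (hH : IsSubordinator H P) :
    potentialMeasure H P (Iio 0) = 0 := by
  rw [potentialMeasure_apply hH measurableSet_Iio]
  simp [not_lt.2 ENNReal.toReal_nonneg]

/-- The laws of `H t` restricted to `H t < ∞` depend measurably on `t`, because their distribution
functions are monotone in `t`. -/
theorem measurable_map_subordinator [IsProbabilityMeasure P] (hH : IsSubordinator H P) :
    Measurable fun t : ℝ =>
      (P.restrict {ω | H t.toNNReal ω < ∞}).map fun ω => (H t.toNNReal ω).toReal := by
  have happ : ∀ (t : ℝ) {B : Set ℝ}, MeasurableSet B →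
      (P.restrict {ω | H t.toNNReal ω < ∞}).map (fun ω => (H t.toNNReal ω).toReal) B
        = P {ω | H t.toNNReal ω < ∞ ∧ (H t.toNNReal ω).toReal ∈ B} := by
    intro t B hB
    have hm := hH.measurable t.toNNReal
    rw [Measure.map_apply hm.ennreal_toReal hB, Measure.restrict_apply (hm.ennreal_toReal hB)]
    congr 1
    ext ω
    simp [and_comm]
  have hanti : ∀ c : ℝ, Antitone fun t : ℝ =>
      P {ω | H t.toNNReal ω < ∞ ∧ (H t.toNNReal ω).toReal ≤ c} := by
    intro c r t hrt
    refine measure_mono_ae ?_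
    filter_upwards [hH.paths] with ω hω h
    have hle := hω.2.1 (Real.toNNReal_le_toNNReal hrt)
    exact ⟨hle.trans_lt h.1, (ENNReal.toReal_mono h.1.ne hle).trans h.2⟩
  have hanti' : Antitone fun t : ℝ => P {ω | H t.toNNReal ω < ∞} := by
    intro r t hrt
    refine measure_mono_ae ?_
    filter_upwards [hH.paths] with ω hω h
    exact (hω.2.1 (Real.toNNReal_le_toNNReal hrt)).trans_lt h
  have hfin : ∀ t : ℝ, IsFiniteMeasure
      ((P.restrict {ω | H t.toNNReal ω < ∞}).map fun ω => (H t.toNNReal ω).toReal) :=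
    fun t => inferInstance
  refine Measurable.measure_of_isPiSystem (borel_eq_generateFrom_Iic ℝ ▸
    BorelSpace.measurable_eq) isPiSystem_Iic ?_ ?_
  · rintro _ ⟨c, rfl⟩
    simp_rw [happ _ measurableSet_Iic]
    exact (hanti c).measurable
  · simp_rw [happ _ MeasurableSet.univ]
    simpa using hanti'.measurable

/-- The potential measure has Laplace transform `∫_0^∞ exp (-t φ(θ)) dt = 1 / φ(θ)`. -/
theorem laplaceTransform_potentialMeasure [IsProbabilityMeasure P] (hH : IsSubordinator H P)
    {φ : ℝ → ℝ} (hφ : HasLaplaceExponent H P φ) {θ : ℝ} (hθ : 0 ≤ θ) (hpos : 0 < φ θ) :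
    laplaceTransform (potentialMeasure H P) θ = ENNReal.ofReal (1 / φ θ) := by
  rw [laplaceTransform, potentialMeasure,
    Measure.lintegral_bind (measurable_map_subordinator hH).aemeasurable (by fun_prop)]
  have hinner : ∀ t : ℝ, 0 ≤ t → ∫⁻ x, ENNReal.ofReal (Real.exp (-θ * x))
      ∂((P.restrict {ω | H t.toNNReal ω < ∞}).map fun ω => (H t.toNNReal ω).toReal)
      = ENNReal.ofReal (Real.exp (-φ θ * t)) := by
    intro t ht
    have hm := (hH.measurable t.toNNReal).ennreal_toReal
    rw [lintegral_map (by fun_prop) hm, ← ofReal_integral_eq_lintegral_ofReal,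
      hφ t.toNNReal θ hθ, Real.coe_toNNReal t ht]
    · congr 2; ring
    · refine Integrable.of_bound
        (Real.measurable_exp.comp (hm.const_mul (-θ))).aestronglyMeasurable 1
        (ae_of_all _ fun ω => ?_)
      rw [Real.norm_of_nonneg (Real.exp_pos _).le, Real.exp_le_one_iff]
      have : 0 ≤ (H t.toNNReal ω).toReal := ENNReal.toReal_nonneg
      nlinarith
    · exact ae_of_all _ fun ω => (Real.exp_pos _).le
  rw [setLIntegral_congr_fun measurableSet_Ici fun t ht => hinner t ht,
    setLIntegral_congr Ioi_ae_eq_Ici.symm, ← ofReal_integral_eq_lintegral_ofReal]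
  · rw [integral_exp_mul_Ioi (by linarith)]
    simp
  · exact exp_neg_integrableOn_Ioi 0 hpos
  · exact ae_of_all _ fun t => (Real.exp_pos _).le

end Potential

/-! ### Laplace transforms of tails, and convex functions as tails -/

theorem lintegral_exp_neg_Ioi {θ : ℝ} (hθ : 0 < θ) :
    ∫⁻ x in Ioi (0 : ℝ), ENNReal.ofReal (Real.exp (-θ * x)) = ENNReal.ofReal (1 / θ) := by
  rw [← ofReal_integral_eq_lintegral_ofReal (exp_neg_integrableOn_Ioi 0 hθ)
    (ae_of_all _ fun t => (Real.exp_pos _).le), integral_exp_mul_Ioi (by linarith)]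
  simp

theorem lintegral_exp_neg_Ioo {θ y : ℝ} (hθ : 0 < θ) (hy : 0 < y) :
    ∫⁻ x in Ioo 0 y, ENNReal.ofReal (Real.exp (-θ * x))
      = ENNReal.ofReal (1 / θ) * ENNReal.ofReal (1 - Real.exp (-θ * y)) := by
  have hi : IntervalIntegrable (fun x => Real.exp (-θ * x)) volume 0 y :=
    Continuous.intervalIntegrable (by fun_prop) _ _
  have hval : ∫ x in (0 : ℝ)..y, Real.exp (-θ * x) = 1 / θ * (1 - Real.exp (-θ * y)) := by
    rw [intervalIntegral.integral_eq_sub_of_hasDerivAt (f := fun x => -(1 / θ) * Real.exp (-θ * x))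
      (fun x _ => ?_) hi]
    · simp only [mul_zero, Real.exp_zero]
      ring
    · have h1 : HasDerivAt (fun x : ℝ => -θ * x) (-θ) x := by
        simpa using (hasDerivAt_id x).const_mul (-θ)
      have h2 := h1.exp.const_mul (-(1 / θ))
      refine h2.congr_deriv ?_
      have : 1 / θ * θ = 1 := one_div_mul_cancel hθ.ne'
      linear_combination Real.exp (-θ * x) * this
  rw [setLIntegral_congr Ioo_ae_eq_Ioc, ← ofReal_integral_eq_lintegral_ofReal
    ((intervalIntegrable_iff_integrableOn_Ioc_of_le hy.le).1 hi)
    (ae_of_all _ fun t => (Real.exp_pos _).le), ← intervalIntegral.integral_of_le hy.le, hval,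
    ENNReal.ofReal_mul (by positivity)]

/-- Tonelli's theorem for `∫_0^∞ exp (-θ x) ∫_x^∞ g(y) dy dx`. -/
theorem lintegral_exp_mul_tail {g : ℝ → ℝ≥0∞} (hg : Measurable g) {θ : ℝ} (hθ : 0 < θ) :
    ∫⁻ x in Ioi (0 : ℝ), ENNReal.ofReal (Real.exp (-θ * x)) * ∫⁻ y in Ioi x, g y
      = ENNReal.ofReal (1 / θ)
        * ∫⁻ y in Ioi (0 : ℝ), ENNReal.ofReal (1 - Real.exp (-θ * y)) * g y := by
  have h1 : ∀ x ∈ Ioi (0 : ℝ), ENNReal.ofReal (Real.exp (-θ * x)) * ∫⁻ y in Ioi x, g y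
      = ∫⁻ y in Ioi (0 : ℝ), ENNReal.ofReal (Real.exp (-θ * x)) * (Ioi x).indicator g y := by
    intro x hx
    have hx0 : (0 : ℝ) < x := hx
    rw [lintegral_const_mul _ (hg.indicator measurableSet_Ioi), setLIntegral_indicator
      measurableSet_Ioi, Ioi_inter_Ioi, sup_eq_left.2 hx0.le]
  rw [setLIntegral_congr_fun measurableSet_Ioi h1, lintegral_lintegral_swap,
    ← lintegral_const_mul _ (by fun_prop)]
  · refine setLIntegral_congr_fun measurableSet_Ioi fun y hy => ?_
    have hy0 : (0 : ℝ) < y := hy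
    have h2 : ∀ x, ENNReal.ofReal (Real.exp (-θ * x)) * (Ioi x).indicator g y
        = (Iio y).indicator (fun x => ENNReal.ofReal (Real.exp (-θ * x))) x * g y := by
      intro x
      by_cases hxy : x < y
      · rw [indicator_of_mem (show y ∈ Ioi x from hxy), indicator_of_mem (show x ∈ Iio y from hxy)]
      · rw [indicator_of_notMem (show y ∉ Ioi x from hxy),
          indicator_of_notMem (show x ∉ Iio y from hxy), mul_zero, zero_mul]
    simp_rw [h2]
    rw [lintegral_mul_const _ (Measurable.indicator (by fun_prop) measurableSet_Iio),
      setLIntegral_indicator measurableSet_Iio, Iio_inter_Ioi, lintegral_exp_neg_Ioo hθ hy0,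
      mul_assoc]
  · refine Measurable.aemeasurable ?_
    refine Measurable.mul (by fun_prop) ?_
    exact (hg.comp measurable_snd).indicator (measurableSet_lt measurable_fst measurable_snd)

section Tail

variable {κ : ℝ} {f : ℝ → ℝ}

theorem ofReal_levyTail (hκ : 0 ≤ κ) (hf : ∀ y ∈ Ioi (0 : ℝ), 0 ≤ f y) {x : ℝ} (hx : 0 < x)
    (hi : IntegrableOn f (Ioi x)) :
    ENNReal.ofReal (levyTail κ f x)
      = ENNReal.ofReal κ
        + ∫⁻ y in Ioi x, (Ioi (0 : ℝ)).indicator (fun y => ENNReal.ofReal (f y)) y := by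
  have hnn : ∀ y ∈ Ioi x, 0 ≤ f y := fun y hy => hf y (hx.trans hy)
  rw [levyTail, ENNReal.ofReal_add hκ (setIntegral_nonneg measurableSet_Ioi hnn),
    ofReal_integral_eq_lintegral_ofReal hi]
  · congr 1
    refine setLIntegral_congr_fun measurableSet_Ioi fun y hy => ?_
    rw [indicator_of_mem (show y ∈ Ioi (0 : ℝ) from hx.trans hy)]
  · filter_upwards [ae_restrict_mem measurableSet_Ioi] with y hy using hnn y hy

/-- The Laplace transform of a tail: `κ / θ + θ⁻¹ ∫ (1 - exp (-θ y)) f(y) dy`. -/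
theorem lintegral_exp_mul_levyTail (hκ : 0 ≤ κ) (hf : ∀ y ∈ Ioi (0 : ℝ), 0 ≤ f y)
    (hm : Measurable ((Ioi (0 : ℝ)).indicator fun y => ENNReal.ofReal (f y)))
    (hi : ∀ x, 0 < x → IntegrableOn f (Ioi x)) {θ : ℝ} (hθ : 0 < θ) :
    ∫⁻ x in Ioi (0 : ℝ), ENNReal.ofReal (Real.exp (-θ * x)) * ENNReal.ofReal (levyTail κ f x)
      = ENNReal.ofReal (κ / θ) + ENNReal.ofReal (1 / θ)
        * ∫⁻ y in Ioi (0 : ℝ), ENNReal.ofReal ((1 - Real.exp (-θ * y)) * f y) := by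
  have h1 : ∀ x ∈ Ioi (0 : ℝ),
      ENNReal.ofReal (Real.exp (-θ * x)) * ENNReal.ofReal (levyTail κ f x)
      = ENNReal.ofReal (Real.exp (-θ * x)) * ENNReal.ofReal κ
        + ENNReal.ofReal (Real.exp (-θ * x))
          * ∫⁻ y in Ioi x, (Ioi (0 : ℝ)).indicator (fun y => ENNReal.ofReal (f y)) y := by
    intro x hx
    rw [ofReal_levyTail hκ hf hx (hi x hx), mul_add]
  rw [setLIntegral_congr_fun measurableSet_Ioi h1, lintegral_add_left (by fun_prop),
    lintegral_mul_const _ (by fun_prop), lintegral_exp_neg_Ioi hθ, lintegral_exp_mul_tail hm hθ,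
    ← ENNReal.ofReal_mul (by positivity)]
  congr 2
  · ring_nf
  · refine setLIntegral_congr_fun measurableSet_Ioi fun y hy => ?_
    have hy0 : (0 : ℝ) < y := hy
    rw [indicator_of_mem hy, ENNReal.ofReal_mul (one_sub_exp_nonneg hθ.le hy0.le)]

theorem continuousOn_levyTail (hi : ∀ x, 0 < x → IntegrableOn f (Ioi x)) :
    ContinuousOn (levyTail κ f) (Ioi 0) := by
  intro x hx
  have hx0 : (0 : ℝ) < x := hx
  set a := x / 2 with ha
  have ha0 : 0 < a := by positivity
  have hint : Integrable ((Ioi a).indicator f) :=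
    (integrable_indicator_iff measurableSet_Ioi).2 (hi a ha0)
  have hcont : Continuous fun y => levyTail κ f a - ∫ t in a..y, (Ioi a).indicator f t :=
    continuous_const.sub
      (intervalIntegral.continuous_primitive (fun _ _ => hint.intervalIntegrable) a)
  refine (hcont.continuousAt.congr ?_).continuousWithinAt
  filter_upwards [Ioi_mem_nhds (show a < x by rw [ha]; linarith)] with y hy
  have hay : a < y := hy
  rw [intervalIntegral.integral_of_le hay.le, setIntegral_indicator measurableSet_Ioi,
    show Ioc a y ∩ Ioi a = Ioc a y from inter_eq_left.2 Ioc_subset_Ioi_self]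
  have := levyTail_sub_levyTail (κ := κ) (hi a ha0) hay.le
  linarith

end Tail

/-- A non-increasing convex function on `(0, ∞)` is the tail of a measure with non-increasing
density, namely minus its right derivative, and with a mass `c` at infinity. -/
theorem exists_eq_levyTail {u : ℝ → ℝ} (hu0 : ∀ x ∈ Ioi (0 : ℝ), 0 ≤ u x)
    (hanti : AntitoneOn u (Ioi 0)) (hconv : ConvexOn ℝ (Ioi 0) u) :
    ∃ (c : ℝ) (w : ℝ → ℝ), 0 ≤ c ∧ (∀ x ∈ Ioi (0 : ℝ), 0 ≤ w x) ∧ Measurable w ∧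
      AntitoneOn w (Ioi 0) ∧ (∀ x, 0 < x → IntegrableOn w (Ioi x)) ∧
      ∀ x ∈ Ioi (0 : ℝ), u x = levyTail c w x := by
  set w : ℝ → ℝ := fun x => -derivWithin u (Ioi x) x with hw
  have hwanti : AntitoneOn w (Ioi 0) := by
    have := hconv.monotoneOn_rightDeriv
    rw [interior_Ioi] at this
    exact this.neg
  have hder : ∀ x ∈ Ioi (0 : ℝ), HasDerivWithinAt u (-w x) (Ioi x) x := by
    intro x hx
    rw [hw, neg_neg]
    exact hconv.hasDerivWithinAt_rightDeriv_of_mem_interior (by rwa [interior_Ioi])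
  have hw0 : ∀ x ∈ Ioi (0 : ℝ), 0 ≤ w x := by
    intro x hx
    have hx0 : (0 : ℝ) < x := hx
    have hx1 : x + 1 ∈ Ioi (0 : ℝ) := by simp only [mem_Ioi]; linarith
    have h := hconv.rightDeriv_le_slope hx hx1 (by linarith)
      (hder x hx).differentiableWithinAt
    rw [slope_def_field] at h
    have h2 := hanti hx hx1 (by linarith)
    have h3 : x + 1 - x = 1 := by ring
    rw [h3, div_one] at h
    simp only [hw]
    linarith
  have hint : ∀ a b, 0 < a → a ≤ b → IntervalIntegrable w volume a b := fun a b ha hab =>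
    AntitoneOn.intervalIntegrable (hwanti.mono fun x hx => by
      rw [uIcc_of_le hab] at hx; exact ha.trans_le hx.1)
  have hftc : ∀ a b, 0 < a → a ≤ b → ∫ x in a..b, w x = u a - u b := by
    intro a b ha hab
    have hsub : Icc a b ⊆ Ioi 0 := fun x hx => ha.trans_le hx.1
    have h := intervalIntegral.integral_eq_sub_of_hasDeriv_right_of_le hab
      ((hconv.continuousOn isOpen_Ioi).mono hsub)
      (fun x hx => hder x (hsub (Ioo_subset_Icc_self hx))) (hint a b ha hab).neg
    rw [intervalIntegral.integral_neg] at h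
    linarith
  have hmax : ∀ x : ℝ, max x 1 ∈ Ioi (0 : ℝ) := fun x =>
    show (0 : ℝ) < max x 1 from lt_max_of_lt_right one_pos
  have hvanti : Antitone fun x => u (max x 1) := fun x y hxy =>
    hanti (hmax x) (hmax y) (max_le_max hxy le_rfl)
  have hbdd : BddBelow (range fun x => u (max x 1)) :=
    ⟨0, by rintro _ ⟨x, rfl⟩; exact hu0 _ (hmax x)⟩
  set c := ⨅ x, u (max x 1)
  have hlim : Tendsto u atTop (𝓝 c) := by
    refine (tendsto_atTop_ciInf hvanti hbdd).congr' ?_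
    filter_upwards [eventually_ge_atTop 1] with x hx
    rw [max_eq_left hx]
  have hprim : ∀ a, 0 < a → Tendsto (fun n : ℕ => ∫ x in a..(a + n), w x) atTop (𝓝 (u a - c)) := by
    intro a ha
    have hb : Tendsto (fun n : ℕ => a + (n : ℝ)) atTop atTop :=
      tendsto_atTop_add_const_left _ _ tendsto_natCast_atTop_atTop
    refine (tendsto_const_nhds.sub (hlim.comp hb)).congr fun n => ?_
    exact (hftc a (a + n) ha (by simp)).symm
  have hwint : ∀ x, 0 < x → IntegrableOn w (Ioi x) := by
    intro x hx
    have hb : Tendsto (fun n : ℕ => x + (n : ℝ)) atTop atTop :=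
      tendsto_atTop_add_const_left _ _ tendsto_natCast_atTop_atTop
    refine integrableOn_Ioi_of_intervalIntegral_norm_tendsto (u x - c) x (fun n : ℕ => ?_) hb ?_
    · exact (intervalIntegrable_iff_integrableOn_Ioc_of_le (by simp)).1
        (hint x (x + n) hx (by simp))
    · refine (hprim x hx).congr fun n => intervalIntegral.integral_congr fun y hy => ?_
      rw [uIcc_of_le (by simp)] at hy
      exact (Real.norm_of_nonneg (hw0 y (hx.trans_le hy.1))).symm
  refine ⟨c, w, le_ciInf fun x => hu0 _ (hmax x), hw0, (measurable_derivWithin_Ioi u).neg, hwanti,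
    hwint, fun x hx => ?_⟩
  have hb : Tendsto (fun n : ℕ => x + (n : ℝ)) atTop atTop :=
    tendsto_atTop_add_const_left _ _ tendsto_natCast_atTop_atTop
  have := tendsto_nhds_unique (hprim x hx) (intervalIntegral_tendsto_integral_Ioi x (hwint x hx) hb)
  rw [levyTail, ← this]
  ring

/-! ### The derivative of the potential density when the drift is positive -/

section Drift

variable {κ d : ℝ} {Υ : ℝ → ℝ}

theorem LogConvexOn.mul_le_laplaceExponent (hlog : LogConvexOn (Ioi 0) Υ) (hκ : 0 ≤ κ) {θ : ℝ}
    (hθ : 0 ≤ θ) : d * θ ≤ laplaceExponent κ d Υ θ := by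
  have : 0 ≤ ∫ x in Ioi (0 : ℝ), (1 - Real.exp (-θ * x)) * Υ x :=
    setIntegral_nonneg measurableSet_Ioi fun x hx =>
      mul_nonneg (one_sub_exp_nonneg hθ (le_of_lt hx)) (hlog.1 x hx).le
  unfold laplaceExponent
  linarith

/-- The drift is the linear growth rate of the Laplace exponent. -/
theorem LogConvexOn.tendsto_laplaceExponent_div (hlog : LogConvexOn (Ioi 0) Υ)
    (hint : IntegrableOn (fun x => min 1 x * Υ x) (Ioi 0)) :
    Tendsto (fun θ => laplaceExponent κ d Υ θ / θ) atTop (𝓝 d) := by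
  have hJ : Tendsto (fun θ => ∫ x in Ioi (0 : ℝ), (1 - Real.exp (-θ * x)) / θ * Υ x) atTop
      (𝓝 (∫ x in Ioi (0 : ℝ), 0 * Υ x)) := by
    have hle : ∀ θ x : ℝ, 0 < θ → (1 - Real.exp (-θ * x)) / θ ≤ 1 / θ := fun θ x hθ =>
      div_le_div_of_nonneg_right (by linarith [Real.exp_pos (-θ * x)]) hθ.le
    refine tendsto_integral_filter_of_dominated_convergence (fun x => min 1 x * Υ x) ?_ ?_ hint ?_
    · exact Eventually.of_forall fun θ =>
        (Continuous.aestronglyMeasurable (by fun_prop)).mul hlog.aestronglyMeasurable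
    · filter_upwards [eventually_ge_atTop 1] with θ hθ
      filter_upwards [ae_restrict_mem measurableSet_Ioi] with x hx
      have hx0 : (0 : ℝ) < x := hx
      have hθ0 : 0 < θ := by linarith
      have h0 : 0 ≤ (1 - Real.exp (-θ * x)) / θ :=
        div_nonneg (one_sub_exp_nonneg hθ0.le hx0.le) hθ0.le
      rw [norm_mul, Real.norm_of_nonneg h0, Real.norm_of_nonneg (hlog.1 x hx).le]
      refine mul_le_mul_of_nonneg_right (le_min ?_ ?_) (hlog.1 x hx).le
      · exact (hle θ x hθ0).trans ((div_le_one hθ0).2 hθ)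
      · rw [div_le_iff₀ hθ0]
        linarith [Real.add_one_le_exp (-θ * x)]
    · filter_upwards [ae_restrict_mem measurableSet_Ioi] with x hx
      have hx0 : (0 : ℝ) < x := hx
      refine Tendsto.mul_const _ ?_
      refine tendsto_of_tendsto_of_tendsto_of_le_of_le' tendsto_const_nhds
        (tendsto_const_nhds.div_atTop tendsto_id : Tendsto (fun θ : ℝ => 1 / θ) atTop (𝓝 0)) ?_ ?_
      · filter_upwards [eventually_gt_atTop 0] with θ hθ
        exact div_nonneg (one_sub_exp_nonneg hθ.le hx0.le) hθ.le
      · filter_upwards [eventually_gt_atTop 0] with θ hθ using hle θ x hθ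
  have hκ : Tendsto (fun θ : ℝ => κ / θ) atTop (𝓝 0) := tendsto_const_nhds.div_atTop tendsto_id
  have h := (hκ.add (tendsto_const_nhds (x := d))).add hJ
  simp only [zero_mul, integral_zero, zero_add, add_zero] at h
  refine h.congr' ?_
  filter_upwards [eventually_gt_atTop 0] with θ hθ
  rw [laplaceExponent, add_div, add_div, mul_div_cancel_right₀ _ hθ.ne', ← integral_div]
  congr 1
  refine integral_congr_ae (ae_of_all _ fun x => ?_)
  simp only
  ring

theorem LogConvexOn.measurable_indicator (hlog : LogConvexOn (Ioi 0) Υ) :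
    Measurable ((Ioi (0 : ℝ)).indicator fun y => ENNReal.ofReal (Υ y)) := by
  classical
  rw [← piecewise_eq_indicator]
  exact ContinuousOn.measurable_piecewise
    (ENNReal.continuous_ofReal.comp_continuousOn hlog.continuousOn) continuousOn_const
    measurableSet_Ioi

/-- The tail of the Lévy measure has Laplace transform `φ(θ) / θ - d`. -/
theorem LogConvexOn.laplace_levyTail (hlog : LogConvexOn (Ioi 0) Υ)
    (hint : IntegrableOn (fun x => min 1 x * Υ x) (Ioi 0)) (hκ : 0 ≤ κ) {θ : ℝ} (hθ : 0 < θ) :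
    ∫⁻ x in Ioi (0 : ℝ), ENNReal.ofReal (Real.exp (-θ * x)) * ENNReal.ofReal (levyTail κ Υ x)
      = ENNReal.ofReal (laplaceExponent κ d Υ θ / θ - d) := by
  have hnn : ∀ x ∈ Ioi (0 : ℝ), 0 ≤ (1 - Real.exp (-θ * x)) * Υ x := fun x hx =>
    mul_nonneg (one_sub_exp_nonneg hθ.le (le_of_lt hx)) (hlog.1 x hx).le
  rw [lintegral_exp_mul_levyTail hκ (fun y hy => (hlog.1 y hy).le) hlog.measurable_indicator
    (fun x hx => hlog.integrableOn_Ioi hint hx) hθ, ← ofReal_integral_eq_lintegral_ofReal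
    (hlog.integrableOn_one_sub_exp hint hθ.le)
    (by filter_upwards [ae_restrict_mem measurableSet_Ioi] with x hx using hnn x hx),
    ← ENNReal.ofReal_mul (by positivity), ← ENNReal.ofReal_add (by positivity)
    (mul_nonneg (by positivity) (setIntegral_nonneg measurableSet_Ioi hnn))]
  congr 1
  rw [laplaceExponent]
  field_simp
  ring

/-- When the drift is positive, minus the derivative of the potential density has Laplace transform
`1 / d - θ / φ(θ)`. The constant is the value of the density at `0+`, found by letting
`θ → ∞`. -/
theorem LogConvexOn.lintegral_exp_mul_deriv_density {U : Measure ℝ}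
    (hlog : LogConvexOn (Ioi 0) Υ) (hint : IntegrableOn (fun x => min 1 x * Υ x) (Ioi 0))
    (hκ : 0 ≤ κ) (hd : 0 < d)
    (hU : ∀ θ, 0 < θ → laplaceTransform U θ = ENNReal.ofReal (1 / laplaceExponent κ d Υ θ))
    {c : ℝ} {w : ℝ → ℝ} (hc : 0 ≤ c) (hw0 : ∀ x ∈ Ioi (0 : ℝ), 0 ≤ w x) (hwm : Measurable w)
    (hwi : ∀ x, 0 < x → IntegrableOn w (Ioi x))
    (hUd : U.restrict (Ioi 0)
      = (volume.restrict (Ioi 0)).withDensity fun x => ENNReal.ofReal (levyTail c w x))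
    {θ : ℝ} (hθ : 0 < θ) :
    ∫⁻ x in Ioi (0 : ℝ), ENNReal.ofReal (Real.exp (-θ * x)) * ENNReal.ofReal (w x)
      = ENNReal.ofReal (1 / d - θ / laplaceExponent κ d Υ θ) := by
  set φ := laplaceExponent κ d Υ with hφ
  have hφpos : ∀ θ, 0 < θ → 0 < φ θ := fun θ hθ => hlog.laplaceExponent_pos hint hκ hd.le hθ
  have hφle : ∀ θ, 0 < θ → d * θ ≤ φ θ := fun θ hθ => hlog.mul_le_laplaceExponent hκ hθ.le
  set A : ℝ → ℝ≥0∞ := fun θ =>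
    ∫⁻ y in Ioi (0 : ℝ), ENNReal.ofReal ((1 - Real.exp (-θ * y)) * w y) with hA
  have hwm' : Measurable ((Ioi (0 : ℝ)).indicator fun y => ENNReal.ofReal (w y)) :=
    hwm.ennreal_ofReal.indicator measurableSet_Ioi
  have hsplit : ∀ θ, 0 < θ → ENNReal.ofReal (1 / φ θ)
      = (ENNReal.ofReal (c / θ) + ENNReal.ofReal (1 / θ) * A θ)
        + ∫⁻ x in (Ioi (0 : ℝ))ᶜ, ENNReal.ofReal (Real.exp (-θ * x)) ∂U := by
    intro θ hθ
    rw [← hU θ hθ, laplaceTransform, ← lintegral_add_compl _ measurableSet_Ioi, hUd,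
      lintegral_withDensity_eq_lintegral_mul₀ ?_ (by fun_prop)]
    · simp only [Pi.mul_apply]
      rw [← lintegral_exp_mul_levyTail hc hw0 hwm' hwi hθ]
      simp_rw [mul_comm]
    · exact ((continuousOn_levyTail hwi).aemeasurable measurableSet_Ioi).ennreal_ofReal
  have hbound : ∀ θ, 0 < θ → ENNReal.ofReal (1 / φ θ) ≤ ENNReal.ofReal (1 / (d * θ)) :=
    fun θ hθ => ENNReal.ofReal_le_ofReal
      (one_div_le_one_div_of_le (by positivity) (hφle θ hθ))
  -- there is no atom at `0`
  have hatom : U (Ioi (0 : ℝ))ᶜ = 0 := by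
    have hle : ∀ n : ℕ, U (Ioi (0 : ℝ))ᶜ ≤ ENNReal.ofReal (1 / (d * ((n : ℝ) + 1))) := by
      intro n
      have hn : (0 : ℝ) < n + 1 := by positivity
      refine le_trans ?_ (hbound _ hn)
      rw [hsplit _ hn]
      refine le_trans ?_ le_add_self
      rw [← setLIntegral_one]
      refine setLIntegral_mono' measurableSet_Ioi.compl fun x hx => ?_
      rw [← ENNReal.ofReal_one]
      refine ENNReal.ofReal_le_ofReal (Real.one_le_exp ?_)
      have : x ≤ 0 := not_lt.1 hx
      nlinarith
    have hlim : Tendsto (fun n : ℕ => ENNReal.ofReal (1 / (d * ((n : ℝ) + 1)))) atTop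
        (𝓝 (ENNReal.ofReal 0)) :=
      ENNReal.tendsto_ofReal (tendsto_const_nhds.div_atTop
        ((tendsto_atTop_add_const_right _ _ tendsto_natCast_atTop_atTop).const_mul_atTop hd))
    rw [ENNReal.ofReal_zero] at hlim
    exact le_antisymm (ge_of_tendsto' hlim hle) zero_le
  have hsplit' : ∀ θ, 0 < θ → ENNReal.ofReal (1 / φ θ)
      = ENNReal.ofReal (c / θ) + ENNReal.ofReal (1 / θ) * A θ := by
    intro θ hθ
    rw [hsplit θ hθ, setLIntegral_measure_zero _ _ hatom, add_zero]
  have hAle : ∀ θ, 0 < θ → A θ ≤ ENNReal.ofReal (1 / d) := by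
    intro θ hθ
    have h1 : ENNReal.ofReal (1 / θ) * A θ ≤ ENNReal.ofReal (1 / (d * θ)) := by
      refine le_trans ?_ (hbound θ hθ)
      rw [hsplit' θ hθ]
      exact le_add_self
    have h2 : A θ = ENNReal.ofReal θ * (ENNReal.ofReal (1 / θ) * A θ) := by
      rw [← mul_assoc, ← ENNReal.ofReal_mul hθ.le, mul_one_div_cancel hθ.ne', ENNReal.ofReal_one,
        one_mul]
    rw [h2, show 1 / d = θ * (1 / (d * θ)) by field_simp, ENNReal.ofReal_mul hθ.le]
    gcongr
  have hwint : IntegrableOn w (Ioi 0) := by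
    refine ⟨hwm.aestronglyMeasurable, ?_⟩
    rw [hasFiniteIntegral_iff_ofReal
      (by filter_upwards [ae_restrict_mem measurableSet_Ioi] with x hx using hw0 x hx)]
    refine lt_of_le_of_lt ?_ (ENNReal.ofReal_lt_top (r := 1 / d))
    have hlim : Tendsto (fun n : ℕ => A ((n : ℝ) + 1)) atTop
        (𝓝 (∫⁻ y in Ioi (0 : ℝ), ENNReal.ofReal (w y))) := by
      refine lintegral_tendsto_of_tendsto_of_monotone (fun n => by fun_prop) ?_ ?_
      · filter_upwards [ae_restrict_mem measurableSet_Ioi] with y hy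
        have hy0 : (0 : ℝ) < y := hy
        intro n m hnm
        have hnm' : (n : ℝ) ≤ m := by exact_mod_cast hnm
        refine ENNReal.ofReal_le_ofReal (mul_le_mul_of_nonneg_right
          (sub_le_sub_left (Real.exp_le_exp.2 ?_) 1) (hw0 y hy))
        nlinarith
      · filter_upwards [ae_restrict_mem measurableSet_Ioi] with y hy
        have hy0 : (0 : ℝ) < y := hy
        refine ENNReal.tendsto_ofReal ?_
        have h1 : Tendsto (fun n : ℕ => -((n : ℝ) + 1) * y) atTop atBot := by
          have := ((tendsto_atTop_add_const_right atTop (1 : ℝ)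
            (tendsto_natCast_atTop_atTop (R := ℝ))).atTop_mul_const hy0)
          refine (tendsto_neg_atTop_atBot.comp this).congr fun n => ?_
          simp only [Function.comp_apply]
          ring
        have h2 := ((Real.tendsto_exp_atBot.comp h1).const_sub 1).mul_const (w y)
        simpa using h2
    exact le_of_tendsto' hlim fun n => hAle _ (by positivity)
  have hexpint : ∀ θ, 0 < θ → IntegrableOn (fun y => Real.exp (-θ * y) * w y) (Ioi 0) := by
    intro θ hθ
    refine hwint.mono' (by fun_prop) ?_
    filter_upwards [ae_restrict_mem measurableSet_Ioi] with y hy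
    have hy0 : (0 : ℝ) < y := hy
    rw [norm_mul, Real.norm_of_nonneg (Real.exp_pos _).le, Real.norm_of_nonneg (hw0 y hy)]
    exact mul_le_of_le_one_left (hw0 y hy) (Real.exp_le_one_iff.2 (by nlinarith))
  set L : ℝ → ℝ := fun θ => ∫ y in Ioi (0 : ℝ), Real.exp (-θ * y) * w y with hL
  set W := ∫ y in Ioi (0 : ℝ), w y with hW
  have hreal : ∀ θ, 0 < θ → θ / φ θ = c + W - L θ := by
    intro θ hθ
    have hnn : ∀ y ∈ Ioi (0 : ℝ), 0 ≤ (1 - Real.exp (-θ * y)) * w y := fun y hy =>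
      mul_nonneg (one_sub_exp_nonneg hθ.le (le_of_lt hy)) (hw0 y hy)
    have hAi : IntegrableOn (fun y => (1 - Real.exp (-θ * y)) * w y) (Ioi 0) :=
      (hwint.sub (hexpint θ hθ)).congr (ae_of_all _ fun y => by simp only [Pi.sub_apply]; ring)
    have hAval : ∫ y in Ioi (0 : ℝ), (1 - Real.exp (-θ * y)) * w y = W - L θ := by
      rw [hW, hL, ← integral_sub hwint (hexpint θ hθ)]
      exact integral_congr_ae (ae_of_all _ fun y => by ring)
    have h := hsplit' θ hθ
    have hA' : A θ = ENNReal.ofReal (W - L θ) := by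
      rw [hA, ← hAval, ofReal_integral_eq_lintegral_ofReal hAi
        (by filter_upwards [ae_restrict_mem measurableSet_Ioi] with x hx using hnn x hx)]
    have hWL : 0 ≤ W - L θ := by rw [← hAval]; exact setIntegral_nonneg measurableSet_Ioi hnn
    rw [hA', ← ENNReal.ofReal_mul (by positivity), ← ENNReal.ofReal_add (by positivity)
      (by positivity), ENNReal.ofReal_eq_ofReal_iff (one_div_pos.2 (hφpos θ hθ)).le
      (by positivity)] at h
    rw [show θ / φ θ = θ * (1 / φ θ) by ring, h]
    field_simp
    ring
  have hLlim : Tendsto L atTop (𝓝 (∫ y in Ioi (0 : ℝ), 0 * w y)) := by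
    refine tendsto_integral_filter_of_dominated_convergence w
      (Eventually.of_forall fun θ => by fun_prop) ?_ hwint ?_
    · filter_upwards [eventually_gt_atTop 0] with θ hθ
      filter_upwards [ae_restrict_mem measurableSet_Ioi] with y hy
      have hy0 : (0 : ℝ) < y := hy
      rw [norm_mul, Real.norm_of_nonneg (Real.exp_pos _).le, Real.norm_of_nonneg (hw0 y hy)]
      exact mul_le_of_le_one_left (hw0 y hy) (Real.exp_le_one_iff.2 (by nlinarith))
    · filter_upwards [ae_restrict_mem measurableSet_Ioi] with y hy
      refine Tendsto.mul_const _ (Real.tendsto_exp_atBot.comp ?_)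
      exact tendsto_neg_atTop_atBot.atBot_mul_const hy
  simp only [zero_mul, integral_zero] at hLlim
  have hconst : c + W = 1 / d := by
    have h1 : Tendsto (fun θ => θ / φ θ) atTop (𝓝 (1 / d)) := by
      have := (hlog.tendsto_laplaceExponent_div (κ := κ) (d := d) hint).inv₀ hd.ne'
      rw [← one_div] at this
      exact this.congr fun θ => inv_div _ _
    have h2 : Tendsto (fun θ => θ / φ θ) atTop (𝓝 (c + W - 0)) := by
      refine (tendsto_const_nhds.sub hLlim).congr' ?_
      filter_upwards [eventually_gt_atTop 0] with θ hθ using (hreal θ hθ).symm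
    rw [sub_zero] at h2
    exact tendsto_nhds_unique h2 h1
  rw [hreal θ hθ, ← hconst, show c + W - (c + W - L θ) = L θ by ring, hL]
  simp only
  rw [ofReal_integral_eq_lintegral_ofReal (hexpint θ hθ)]
  · simp_rw [ENNReal.ofReal_mul (Real.exp_pos _).le]
  · filter_upwards [ae_restrict_mem measurableSet_Ioi] with y hy
    exact mul_nonneg (Real.exp_pos _).le (hw0 y hy)

end Drift

/-! ### Continuity of the derivative -/

section Convolution

variable {B W : ℝ → ℝ≥0∞}

theorem measurable_lintegral_conv (hB : Measurable B) (hW : Measurable W) :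
    Measurable fun x => ∫⁻ y, B (x - y) * W y :=
  Measurable.lintegral_prod_right' (f := fun p : ℝ × ℝ => B (p.1 - p.2) * W p.2)
    ((hB.comp (measurable_fst.sub measurable_snd)).mul (hW.comp measurable_snd))

theorem lintegral_exp_mul_conv (hB : Measurable B) (hW : Measurable W) (θ : ℝ) :
    ∫⁻ x, ENNReal.ofReal (Real.exp (-θ * x)) * ∫⁻ y, B (x - y) * W y
      = (∫⁻ x, ENNReal.ofReal (Real.exp (-θ * x)) * B x)
        * ∫⁻ y, ENNReal.ofReal (Real.exp (-θ * y)) * W y := by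
  have h1 : ∀ x, ENNReal.ofReal (Real.exp (-θ * x)) * ∫⁻ y, B (x - y) * W y
      = ∫⁻ y, (ENNReal.ofReal (Real.exp (-θ * (x - y))) * B (x - y))
        * (ENNReal.ofReal (Real.exp (-θ * y)) * W y) := by
    intro x
    rw [← lintegral_const_mul _ (by fun_prop)]
    refine lintegral_congr fun y => ?_
    rw [show -θ * x = -θ * (x - y) + -θ * y by ring, Real.exp_add,
      ENNReal.ofReal_mul (Real.exp_pos _).le]
    ring
  simp_rw [h1]
  rw [lintegral_lintegral_swap (Measurable.aemeasurable (by fun_prop)),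
    ← lintegral_const_mul _ (by fun_prop)]
  refine lintegral_congr fun y => ?_
  rw [lintegral_mul_const _ (by fun_prop),
    lintegral_sub_right_eq_self (fun x => ENNReal.ofReal (Real.exp (-θ * x)) * B x) y]

/-- The substitution `y = x t` in a convolution. -/
theorem lintegral_conv_eq_mul (hB : Measurable B) (hW : Measurable W) {x : ℝ} (hx : 0 < x) :
    ∫⁻ y, B (x - y) * W y = ENNReal.ofReal x * ∫⁻ t, B (x - x * t) * W (x * t) := by
  conv_lhs => rw [← Real.smul_map_volume_mul_left hx.ne']
  rw [lintegral_smul_measure, lintegral_map (by fun_prop) (by fun_prop), abs_of_pos hx, smul_eq_mul]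

/-- The convolution of non-increasing functions on `(0, ∞)`, one of them continuous, is
continuous as soon as it is finite almost everywhere. On the scale `y = x t` it is dominated, for
`x` near `x₀`, by its value at a point `a < x₀` where it is finite, and the other function is
continuous at `x₀ t` for almost every `t`. -/
theorem continuousAt_lintegral_conv {b w : ℝ → ℝ} (hb : AntitoneOn b (Ioi 0))
    (hbc : ContinuousOn b (Ioi 0)) (hw : AntitoneOn w (Ioi 0))
    (hBm : Measurable ((Ioi (0 : ℝ)).indicator fun y => ENNReal.ofReal (b y)))
    (hWm : Measurable ((Ioi (0 : ℝ)).indicator fun y => ENNReal.ofReal (w y)))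
    {a x₀ : ℝ} (ha : 0 < a) (hax : a < x₀)
    (hfin : ∫⁻ y, (Ioi (0 : ℝ)).indicator (fun y => ENNReal.ofReal (b y)) (a - y)
      * (Ioi (0 : ℝ)).indicator (fun y => ENNReal.ofReal (w y)) y ≠ ∞) :
    ContinuousAt (fun x => ∫⁻ y, (Ioi (0 : ℝ)).indicator (fun y => ENNReal.ofReal (b y)) (x - y)
      * (Ioi (0 : ℝ)).indicator (fun y => ENNReal.ofReal (w y)) y) x₀ ∧
    ∫⁻ y, (Ioi (0 : ℝ)).indicator (fun y => ENNReal.ofReal (b y)) (x₀ - y)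
      * (Ioi (0 : ℝ)).indicator (fun y => ENNReal.ofReal (w y)) y ≠ ∞ := by
  set B := (Ioi (0 : ℝ)).indicator fun y => ENNReal.ofReal (b y) with hB
  set W := (Ioi (0 : ℝ)).indicator fun y => ENNReal.ofReal (w y) with hW
  have hx₀ : 0 < x₀ := ha.trans hax
  set D : ℝ → ℝ≥0∞ := fun x => ∫⁻ t, B (x - x * t) * W (x * t) with hD
  have hDa : D a ≠ ∞ := by
    rw [lintegral_conv_eq_mul hBm hWm ha] at hfin
    intro h
    apply hfin
    change ENNReal.ofReal a * D a = ∞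
    rw [h, ENNReal.mul_top (by simpa using ha)]
  have hmono : ∀ {g : ℝ → ℝ}, AntitoneOn g (Ioi 0) → ∀ x r, a ≤ x →
      (Ioi (0 : ℝ)).indicator (fun y => ENNReal.ofReal (g y)) (x * r)
        ≤ (Ioi (0 : ℝ)).indicator (fun y => ENNReal.ofReal (g y)) (a * r) := by
    intro g hg x r hax
    have hx : 0 < x := ha.trans_le hax
    by_cases hr : 0 < r
    · have h1 : x * r ∈ Ioi (0 : ℝ) := mul_pos hx hr
      have h2 : a * r ∈ Ioi (0 : ℝ) := mul_pos ha hr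
      rw [indicator_of_mem h1, indicator_of_mem h2]
      exact ENNReal.ofReal_le_ofReal (hg h2 h1 (by nlinarith))
    · have h1 : x * r ∉ Ioi (0 : ℝ) := not_lt.2 (mul_nonpos_of_nonneg_of_nonpos hx.le (not_lt.1 hr))
      rw [indicator_of_notMem h1]
      exact zero_le
  have hdom : ∀ x, a ≤ x → ∀ t, B (x - x * t) * W (x * t) ≤ B (a - a * t) * W (a * t) := by
    intro x hx t
    rw [show x - x * t = x * (1 - t) by ring, show a - a * t = a * (1 - t) by ring]
    exact mul_le_mul' (hmono hb x _ hx) (hmono hw x _ hx)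
  have hcountable : {y | y ∈ Ioi (0 : ℝ) ∧ ¬ContinuousWithinAt w (Ioi 0) y}.Countable :=
    hw.countable_not_continuousWithinAt
  have hgood : ∀ᵐ t : ℝ, t ≠ 0 ∧ t ≠ 1 ∧
      x₀ * t ∉ {y | y ∈ Ioi (0 : ℝ) ∧ ¬ContinuousWithinAt w (Ioi 0) y} := by
    have h1 : ∀ᵐ t : ℝ, x₀ * t ∉ {y | y ∈ Ioi (0 : ℝ) ∧ ¬ContinuousWithinAt w (Ioi 0) y} :=
      (hcountable.preimage (mul_right_injective₀ hx₀.ne')).ae_notMem volume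
    filter_upwards [Measure.ae_ne volume (0 : ℝ), Measure.ae_ne volume (1 : ℝ), h1] with t a b c
    exact ⟨a, b, c⟩
  -- an indicator of a function continuous at a point different from `0` is continuous there
  have hind : ∀ {g : ℝ → ℝ} {y : ℝ}, y ≠ 0 → (y ∈ Ioi (0 : ℝ) → ContinuousWithinAt g (Ioi 0) y) →
      ContinuousAt ((Ioi (0 : ℝ)).indicator fun y => ENNReal.ofReal (g y)) y := by
    intro g y hy hg
    rcases lt_or_gt_of_ne hy with hneg | hpos
    · refine (continuousAt_const (y := (0 : ℝ≥0∞))).congr ?_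
      filter_upwards [Iio_mem_nhds hneg] with z hz
      rw [indicator_of_notMem]
      exact not_lt.2 (le_of_lt (show z < 0 from hz))
    · have hg' : ContinuousAt g y := (hg hpos).continuousAt (Ioi_mem_nhds hpos)
      refine (ENNReal.continuous_ofReal.continuousAt.comp hg').congr ?_
      filter_upwards [Ioi_mem_nhds hpos] with z hz
      rw [indicator_of_mem hz]
      rfl
  have hDcont : ContinuousAt D x₀ := by
    refine tendsto_lintegral_filter_of_dominated_convergence
      (fun t => B (a - a * t) * W (a * t)) ?_ ?_ hDa ?_
    · exact Eventually.of_forall fun x => by fun_prop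
    · filter_upwards [Ioi_mem_nhds hax] with x hx
      exact ae_of_all _ (hdom x (le_of_lt hx))
    · filter_upwards [hgood] with t ht
      obtain ⟨h0, h1, h2⟩ := ht
      have hB1 : ContinuousAt (fun x => B (x - x * t)) x₀ := by
        have hne : x₀ - x₀ * t ≠ 0 := by
          rw [show x₀ - x₀ * t = x₀ * (1 - t) by ring]
          exact mul_ne_zero hx₀.ne' (sub_ne_zero.2 (Ne.symm h1))
        have := hind (g := b) hne fun hm => hbc _ hm
        exact ContinuousAt.comp (f := fun x => x - x * t) this (by fun_prop)
      have hW1 : ContinuousAt (fun x => W (x * t)) x₀ := by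
        have := hind (g := w) (mul_ne_zero hx₀.ne' h0) fun hm => by
          by_contra hcon
          exact h2 ⟨hm, hcon⟩
        exact ContinuousAt.comp (f := fun x => x * t) this (by fun_prop)
      have hne : ∀ {g : ℝ → ℝ} {y : ℝ},
          (Ioi (0 : ℝ)).indicator (fun y => ENNReal.ofReal (g y)) y ≠ ∞ := by
        intro g y
        by_cases h : y ∈ Ioi (0 : ℝ)
        · rw [indicator_of_mem h]; exact ENNReal.ofReal_ne_top
        · rw [indicator_of_notMem h]; exact ENNReal.zero_ne_top
      exact ENNReal.Tendsto.mul hB1 (Or.inr hne) hW1 (Or.inr hne)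
  have hDx : D x₀ ≠ ∞ := ne_top_of_le_ne_top hDa (lintegral_mono (hdom x₀ hax.le))
  refine ⟨?_, ?_⟩
  · have hc : ContinuousAt (fun x => ENNReal.ofReal x * D x) x₀ :=
      ENNReal.Tendsto.mul ENNReal.continuous_ofReal.continuousAt (Or.inr hDx) hDcont
        (Or.inr ENNReal.ofReal_ne_top)
    refine hc.congr ?_
    filter_upwards [Ioi_mem_nhds hx₀] with x hx
    exact (lintegral_conv_eq_mul hBm hWm hx).symm
  · rw [lintegral_conv_eq_mul hBm hWm hx₀]
    exact ENNReal.mul_ne_top ENNReal.ofReal_ne_top hDx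

end Convolution

/-- A monotone function that agrees almost everywhere with a continuous one agrees everywhere. -/
theorem eqOn_of_antitoneOn_of_ae_eq {w R : ℝ → ℝ} (hw : AntitoneOn w (Ioi 0))
    (hR : ContinuousOn R (Ioi 0)) (h : ∀ᵐ x, x ∈ Ioi (0 : ℝ) → w x = R x) :
    EqOn w R (Ioi 0) := by
  intro x hx
  have hx0 : (0 : ℝ) < x := hx
  have hRx : ContinuousAt R x := hR.continuousAt (Ioi_mem_nhds hx)
  have hpick : ∀ a b : ℝ, a < b → ∀ p : ℝ → Prop, (∀ᵐ y, p y) → ∃ y ∈ Ioo a b, p y := by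
    intro a b hab p hp
    have hne : (ae (volume.restrict (Ioo a b))).NeBot := ae_restrict_neBot.2 (by simpa using hab)
    exact ((ae_restrict_mem measurableSet_Ioo).and (ae_restrict_of_ae hp)).exists
  refine le_antisymm (not_lt.1 fun hlt => ?_) (not_lt.1 fun hlt => ?_)
  · obtain ⟨l, r, hlr, hsub⟩ := mem_nhds_iff_exists_Ioo_subset.1
      ((hRx.eventually (gt_mem_nhds hlt)).and (Ioi_mem_nhds hx0))
    obtain ⟨y, hy, hyw⟩ := hpick l x hlr.1 _ h
    obtain ⟨h1, h2⟩ := hsub ⟨hy.1, hy.2.trans hlr.2⟩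
    have := hw h2 hx hy.2.le
    rw [hyw h2] at this
    exact absurd h1 (not_lt.2 this)
  · obtain ⟨l, r, hlr, hsub⟩ := mem_nhds_iff_exists_Ioo_subset.1
      ((hRx.eventually (lt_mem_nhds hlt)).and (Ioi_mem_nhds hx0))
    obtain ⟨y, hy, hyw⟩ := hpick x r hlr.2 _ h
    obtain ⟨h1, h2⟩ := hsub ⟨hlr.1.trans hy.1, hy.2⟩
    have := hw hx h2 hy.1.le
    rw [hyw h2] at this
    exact absurd h1 (not_lt.2 this)

section Drift

variable {κ d : ℝ} {Υ : ℝ → ℝ}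

/-- If `w` is minus the derivative of the potential density of a subordinator with drift `d > 0`,
then `d w + w * Π̄ = Π̄ / d` almost everywhere, where `Π̄ = levyTail κ Υ`: both sides have the
Laplace transform `φ(θ) / (d θ) - 1`. -/
theorem LogConvexOn.deriv_density_add_conv (hlog : LogConvexOn (Ioi 0) Υ)
    (hint : IntegrableOn (fun x => min 1 x * Υ x) (Ioi 0)) (hκ : 0 ≤ κ) (hd : 0 < d)
    {w : ℝ → ℝ} (hwm : Measurable w)
    (hBm : Measurable ((Ioi (0 : ℝ)).indicator fun y => ENNReal.ofReal (levyTail κ Υ y)))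
    (hw : ∀ θ, 0 < θ → ∫⁻ x in Ioi (0 : ℝ), ENNReal.ofReal (Real.exp (-θ * x)) *
      ENNReal.ofReal (w x) = ENNReal.ofReal (1 / d - θ / laplaceExponent κ d Υ θ)) :
    (fun x => ENNReal.ofReal d * (Ioi (0 : ℝ)).indicator (fun y => ENNReal.ofReal (w y)) x
      + ∫⁻ y, (Ioi (0 : ℝ)).indicator (fun y => ENNReal.ofReal (levyTail κ Υ y)) (x - y)
        * (Ioi (0 : ℝ)).indicator (fun y => ENNReal.ofReal (w y)) y)
      =ᵐ[volume] fun x => ENNReal.ofReal (1 / d)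
        * (Ioi (0 : ℝ)).indicator (fun y => ENNReal.ofReal (levyTail κ Υ y)) x := by
  set B := (Ioi (0 : ℝ)).indicator fun y => ENNReal.ofReal (levyTail κ Υ y) with hB
  set W := (Ioi (0 : ℝ)).indicator fun y => ENNReal.ofReal (w y) with hW
  have hWm : Measurable W := hwm.ennreal_ofReal.indicator measurableSet_Ioi
  have hCm := measurable_lintegral_conv hBm hWm
  have hB0 : ∀ x ∈ Iio (0 : ℝ), B x = 0 := fun x hx =>
    indicator_of_notMem (not_lt.2 (le_of_lt hx)) _
  have hW0 : ∀ x : ℝ, x ≤ 0 → W x = 0 := fun x hx => indicator_of_notMem (not_lt.2 hx) _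
  have hC0 : ∀ x ∈ Iio (0 : ℝ), ∫⁻ y, B (x - y) * W y = 0 := by
    intro x hx
    have hx0 : x < 0 := hx
    refine (lintegral_congr fun y => ?_).trans lintegral_zero
    rcases le_or_gt y 0 with hy | hy
    · rw [hW0 y hy, mul_zero]
    · rw [hB0 (x - y) (by simp only [mem_Iio]; linarith), zero_mul]
  have hind : ∀ (g : ℝ → ℝ) (θ : ℝ), ∫⁻ x, ENNReal.ofReal (Real.exp (-θ * x))
      * (Ioi (0 : ℝ)).indicator (fun y => ENNReal.ofReal (g y)) x
      = ∫⁻ x in Ioi (0 : ℝ), ENNReal.ofReal (Real.exp (-θ * x)) * ENNReal.ofReal (g x) := by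
    intro g θ
    rw [← lintegral_indicator measurableSet_Ioi]
    refine lintegral_congr fun x => ?_
    by_cases hx : x ∈ Ioi (0 : ℝ)
    · rw [indicator_of_mem hx, indicator_of_mem hx]
    · rw [indicator_of_notMem hx, indicator_of_notMem hx, mul_zero]
  have hLB : ∀ θ, 0 < θ → ∫⁻ x, ENNReal.ofReal (Real.exp (-θ * x)) * B x
      = ENNReal.ofReal (laplaceExponent κ d Υ θ / θ - d) := fun θ hθ => by
    rw [hB, hind, hlog.laplace_levyTail hint hκ hθ]
  have hLW : ∀ θ, 0 < θ → ∫⁻ x, ENNReal.ofReal (Real.exp (-θ * x)) * W x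
      = ENNReal.ofReal (1 / d - θ / laplaceExponent κ d Υ θ) := fun θ hθ => by
    rw [hW, hind, hw θ hθ]
  set f := fun x => ENNReal.ofReal d * W x + ∫⁻ y, B (x - y) * W y with hf
  set g := fun x => ENNReal.ofReal (1 / d) * B x with hg
  have hfm : Measurable f := (hWm.const_mul _).add hCm
  have hgm : Measurable g := hBm.const_mul _
  have hlap : ∀ {f : ℝ → ℝ≥0∞}, Measurable f → ∀ θ, laplaceTransform (volume.withDensity f) θ
      = ∫⁻ x, ENNReal.ofReal (Real.exp (-θ * x)) * f x := by
    intro f hf θ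
    rw [laplaceTransform, lintegral_withDensity_eq_lintegral_mul _ hf (by fun_prop)]
    simp only [Pi.mul_apply, mul_comm]
  have hneg : ∀ {f : ℝ → ℝ≥0∞}, (∀ x ∈ Iio (0 : ℝ), f x = 0) →
      volume.withDensity f (Iio 0) = 0 := by
    intro f hf
    rw [withDensity_apply _ measurableSet_Iio, setLIntegral_congr_fun measurableSet_Iio hf,
      lintegral_zero]
  have hlapg : ∀ θ, 0 < θ → laplaceTransform (volume.withDensity g) θ
      = ENNReal.ofReal (1 / d) * ENNReal.ofReal (laplaceExponent κ d Υ θ / θ - d) := by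
    intro θ hθ
    rw [hlap hgm, ← hLB θ hθ, ← lintegral_const_mul _ (by fun_prop)]
    exact lintegral_congr fun x => by simp only [hg]; ring
  have hlapf : ∀ θ, 0 < θ → laplaceTransform (volume.withDensity f) θ
      = ENNReal.ofReal d * ENNReal.ofReal (1 / d - θ / laplaceExponent κ d Υ θ)
        + ENNReal.ofReal (laplaceExponent κ d Υ θ / θ - d)
          * ENNReal.ofReal (1 / d - θ / laplaceExponent κ d Υ θ) := by
    intro θ hθ
    rw [hlap hfm, ← hLB θ hθ, ← hLW θ hθ, ← lintegral_exp_mul_conv hBm hWm,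
      ← lintegral_const_mul _ (by fun_prop), ← lintegral_add_left (by fun_prop)]
    exact lintegral_congr fun x => by simp only [hf]; ring
  refine (withDensity_eq_iff_of_sigmaFinite hfm.aemeasurable hgm.aemeasurable).1 ?_
  refine measure_ext_of_laplaceTransform (hneg fun x hx => ?_) (hneg fun x hx => ?_) ?_ fun k => ?_
  · simp only [hf]
    rw [hC0 x hx, hW0 x (le_of_lt hx), mul_zero, add_zero]
  · simp only [hg]
    rw [hB0 x hx, mul_zero]
  · rw [hlapg 1 one_pos]
    exact ENNReal.mul_ne_top ENNReal.ofReal_ne_top ENNReal.ofReal_ne_top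
  · have hθ : (0 : ℝ) < k + 1 := by positivity
    rw [hlapf _ hθ, hlapg _ hθ]
    set θ : ℝ := (k : ℝ) + 1
    set p := laplaceExponent κ d Υ θ
    have hp : 0 < p := hlog.laplaceExponent_pos hint hκ hd.le hθ
    have hle : d * θ ≤ p := hlog.mul_le_laplaceExponent hκ hθ.le
    have h1 : 0 ≤ p / θ - d := sub_nonneg.2 ((le_div_iff₀ hθ).2 hle)
    have h2 : 0 ≤ 1 / d - θ / p := by
      rw [sub_nonneg, div_le_div_iff₀ hp hd]
      linarith
    rw [← ENNReal.ofReal_mul hd.le, ← ENNReal.ofReal_mul h1, ← ENNReal.ofReal_mul (by positivity),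
      ← ENNReal.ofReal_add (by positivity) (by positivity)]
    congr 1
    field_simp
    ring

/-- If the drift is positive, the potential density is continuously differentiable. -/
theorem LogConvexOn.contDiffOn_density {U : Measure ℝ} (hlog : LogConvexOn (Ioi 0) Υ)
    (hint : IntegrableOn (fun x => min 1 x * Υ x) (Ioi 0)) (hκ : 0 ≤ κ) (hd : 0 < d)
    (hU : ∀ θ, 0 < θ → laplaceTransform U θ = ENNReal.ofReal (1 / laplaceExponent κ d Υ θ))
    {u : ℝ → ℝ} (hu0 : ∀ x ∈ Ioi (0 : ℝ), 0 ≤ u x)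
    (hUd : U.restrict (Ioi 0)
      = (volume.restrict (Ioi 0)).withDensity fun x => ENNReal.ofReal (u x))
    (hanti : AntitoneOn u (Ioi 0)) (hconv : ConvexOn ℝ (Ioi 0) u) :
    ContDiffOn ℝ 1 u (Ioi 0) := by
  obtain ⟨c, w, hc, hw0, hwm, hwanti, hwi, huw⟩ := exists_eq_levyTail hu0 hanti hconv
  have hUd' : U.restrict (Ioi 0)
      = (volume.restrict (Ioi 0)).withDensity fun x => ENNReal.ofReal (levyTail c w x) := by
    rw [hUd]
    refine withDensity_congr_ae ?_
    filter_upwards [ae_restrict_mem measurableSet_Ioi] with x hx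
    rw [huw x hx]
  have hΥi : ∀ x, 0 < x → IntegrableOn Υ (Ioi x) := fun x hx => hlog.integrableOn_Ioi hint hx
  have hβc : ContinuousOn (levyTail κ Υ) (Ioi 0) := continuousOn_levyTail hΥi
  have hβa : AntitoneOn (levyTail κ Υ) (Ioi 0) := by
    intro x hx y _ hxy
    rcases hxy.eq_or_lt with rfl | hxy
    · exact le_rfl
    · exact (hlog.levyTail_anti hint hx hxy).le
  have hβ0 : ∀ x ∈ Ioi (0 : ℝ), 0 < levyTail κ Υ x := fun x hx => hlog.levyTail_pos hint hκ hx
  have hBm : Measurable ((Ioi (0 : ℝ)).indicator fun y => ENNReal.ofReal (levyTail κ Υ y)) := by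
    classical
    rw [← piecewise_eq_indicator]
    exact ContinuousOn.measurable_piecewise
      (ENNReal.continuous_ofReal.comp_continuousOn hβc) continuousOn_const measurableSet_Ioi
  have hWm : Measurable ((Ioi (0 : ℝ)).indicator fun y => ENNReal.ofReal (w y)) :=
    hwm.ennreal_ofReal.indicator measurableSet_Ioi
  have hae := hlog.deriv_density_add_conv hint hκ hd hwm hBm fun θ hθ =>
    hlog.lintegral_exp_mul_deriv_density hint hκ hd hU hc hw0 hwm hwi hUd' hθ
  set C : ℝ → ℝ≥0∞ := fun x =>
    ∫⁻ y, (Ioi (0 : ℝ)).indicator (fun y => ENNReal.ofReal (levyTail κ Υ y)) (x - y)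
        * (Ioi (0 : ℝ)).indicator (fun y => ENNReal.ofReal (w y)) y with hC
  have hCfin : ∀ᵐ x, x ∈ Ioi (0 : ℝ) → C x ≠ ∞ := by
    filter_upwards [hae] with x hx hx0
    rw [indicator_of_mem hx0, indicator_of_mem hx0] at hx
    have hle : C x ≤ ENNReal.ofReal (1 / d) * ENNReal.ofReal (levyTail κ Υ x) := by
      rw [← hx]; exact le_add_self
    exact ne_top_of_le_ne_top (ENNReal.mul_ne_top ENNReal.ofReal_ne_top ENNReal.ofReal_ne_top) hle
  have hCcont : ∀ x ∈ Ioi (0 : ℝ), ContinuousAt C x ∧ C x ≠ ∞ := by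
    intro x hx
    have hx0 : (0 : ℝ) < x := hx
    have hne : (ae (volume.restrict (Ioo 0 x))).NeBot := ae_restrict_neBot.2 (by simpa using hx0)
    have hev := (ae_restrict_mem (μ := volume) (measurableSet_Ioo (a := 0) (b := x))).and
      (ae_restrict_of_ae hCfin)
    obtain ⟨a, ha, hfin⟩ := hev.exists
    exact continuousAt_lintegral_conv hβa hβc hwanti hBm hWm ha.1 ha.2 (hfin ha.1)
  set R : ℝ → ℝ := fun x => (levyTail κ Υ x / d - (C x).toReal) / d with hR
  have hRc : ContinuousOn R (Ioi 0) := by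
    refine ((hβc.div_const d).sub fun x hx => ?_).div_const d
    obtain ⟨h1, h2⟩ := hCcont x hx
    exact ((ENNReal.tendsto_toReal h2).comp h1).mono_left nhdsWithin_le_nhds
  have hwR : EqOn w R (Ioi 0) := by
    refine eqOn_of_antitoneOn_of_ae_eq hwanti hRc ?_
    filter_upwards [hae] with x hx hx0
    rw [indicator_of_mem hx0, indicator_of_mem hx0] at hx
    have h2 := (hCcont x hx0).2
    have h := congrArg ENNReal.toReal hx
    rw [ENNReal.toReal_add (ENNReal.mul_ne_top ENNReal.ofReal_ne_top ENNReal.ofReal_ne_top) h2,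
      ENNReal.toReal_mul, ENNReal.toReal_mul, ENNReal.toReal_ofReal hd.le,
      ENNReal.toReal_ofReal (hw0 x hx0), ENNReal.toReal_ofReal (by positivity),
      ENNReal.toReal_ofReal (hβ0 x hx0).le] at h
    simp only [hR]
    rw [eq_div_iff hd.ne', div_eq_inv_mul]
    rw [one_div] at h
    linarith
  have hwc : ContinuousOn w (Ioi 0) := hRc.congr hwR
  have hder : ∀ x ∈ Ioi (0 : ℝ), HasDerivAt u (-w x) x := by
    intro x hx
    have hx0 : (0 : ℝ) < x := hx
    set a := x / 2 with ha
    have ha0 : 0 < a := by positivity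
    have hax : a < x := by rw [ha]; linarith
    have hwint : IntervalIntegrable w volume a x :=
      (intervalIntegrable_iff_integrableOn_Ioc_of_le hax.le).2
        ((hwi a ha0).mono_set Ioc_subset_Ioi_self)
    have h1 := (intervalIntegral.integral_hasDerivAt_right hwint
      hwm.stronglyMeasurable.stronglyMeasurableAtFilter
      (hwc.continuousAt (Ioi_mem_nhds hx0))).const_sub (levyTail c w a)
    refine h1.congr_of_eventuallyEq ?_
    filter_upwards [Ioi_mem_nhds hax] with y hy
    have hay : a < y := hy
    have := levyTail_sub_levyTail (κ := c) (hwi a ha0) hay.le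
    rw [huw y (ha0.trans hay), intervalIntegral.integral_of_le hay.le]
    linarith
  have hone : (1 : WithTop ℕ∞) = 0 + 1 := (zero_add 1).symm
  rw [hone, contDiffOn_succ_iff_deriv_of_isOpen isOpen_Ioi]
  refine ⟨fun x hx => (hder x hx).differentiableAt.differentiableWithinAt, by simp, ?_⟩
  rw [contDiffOn_zero]
  exact hwc.neg.congr fun x hx => (hder x hx).deriv

end Drift

theorem corollary2p5 {Ω : Type*} [MeasurableSpace Ω] (P : Measure Ω) [IsProbabilityMeasure P]
    (H : ℝ≥0 → Ω → ℝ≥0∞) (hH : IsSubordinator H P) (κ d : ℝ) (Υ : ℝ → ℝ)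
    (hΥ : HasLevyDensity H P κ d Υ) (hlog : LogConvexOn (Ioi 0) Υ) :
    AntitoneOn Υ (Ioi 0) ∧
    ∃ u : ℝ → ℝ,
      (∀ x ∈ Ioi (0 : ℝ), 0 ≤ u x) ∧
      (potentialMeasure H P).restrict (Ioi 0)
        = (volume.restrict (Ioi 0)).withDensity (fun x => ENNReal.ofReal (u x)) ∧
      AntitoneOn u (Ioi 0) ∧
      ConvexOn ℝ (Ioi 0) u ∧
      (0 < d → ContDiffOn ℝ 1 u (Ioi 0)) := by
  have hU : ∀ θ, 0 < θ → laplaceTransform (potentialMeasure H P) θ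
      = ENNReal.ofReal (1 / laplaceExponent κ d Υ θ) := fun θ hθ =>
    laplaceTransform_potentialMeasure hH hΥ.laplace hθ.le
      (hlog.laplaceExponent_pos hΥ.integrable hΥ.killing_nonneg hΥ.drift_nonneg hθ)
  obtain ⟨u, hu0, hUd, hanti, hconv⟩ := hlog.exists_convex_density hΥ.integrable
    hΥ.killing_nonneg hΥ.drift_nonneg (potentialMeasure_Iio_zero hH) hU
  exact ⟨hlog.antitoneOn hΥ.integrable, u, hu0, hUd, hanti, hconv, fun hd =>
    hlog.contDiffOn_density hΥ.integrable hΥ.killing_nonneg hd hU hu0 hUd hanti hconv⟩
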